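/- **Setting.** Let $\|\cdot\|$ be the Euclidean norm on $\mathbb{R}^d$, let $\mathcal S$ be a set, and for each $s\in\mathcal S$ let $f(\cdot;s):\mathbb{R}^d\to\mathbb{R}$ be convex and $L$-Lipschitz ($L>0$), with a fixed measurable subgradient selection $g_s(x)\in\partial f(x;s)$ for all $x$. For $\rho>0$ let $\gamma_\rho$ be the density of $\mathcal N(0,\rho^2\mathbf I_d)$. Fix $\bar x\in\mathbb{R}^d$, $r,\rho,\beta>0$, $T\in\mathbb{N}$ with $T\ge 1$, $n\ge1$, and let $\Pi$ be the Euclidean projection onto $\{x:\|x-\bar x\|\le r\}$. Put $$k=\lfloor\log_2T\rfloor,\quad \eta=\frac rL\min\Big(\frac1{\sqrt T},\frac{\beta}{\sqrt d}\Big),\quad T_i=2^{k-i},\quad \eta_i=4^{-i}\eta,\quad \sigma_i=\frac{L\eta_i}{\beta}\qquad(1\le i\le k).$$ **Solver.** Given a dataset $\mathcal D=(s_1,\dots,s_n)\in\mathcal S^n$ and indices $z_{i,j}\in\{1,\dots,n\}$ ($1\le i\le k$, $1\le j\le T_i$), start from $x_0=\bar x$. For $i=1,\dots,k$, set $y_0=x_{i-1}$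 and, for $j=1,\dots,T_i$, $$y_j=\Pi\Big(y_{j-1}-\eta_i\,\frac{\gamma_\rho(y_{j-1}-\bar x-\xi_{i,j})}{\gamma_\rho(\xi_{i,j})}\,g_{s_{z_{i,j}}}(\bar x+\xi_{i,j})\Big),\qquad \xi_{i,j}\sim\mathcal N(0,\rho^2\mathbf I_d),$$ and then $x_i=\frac1{T_i}\sum_{j=1}^{T_i}y_j+\zeta_i$ with $\zeta_i\sim\mathcal N(0,\sigma_i^2\mathbf I_d)$. All $\xi_{i,j}$ and $\zeta_i$ are independent. The output is $x_k$. **Divergences.** For probability measures $\mu,\nu$ on $\mathbb{R}^d$ and $\alpha>1$, let $D_\alpha(\mu\|\nu)=\frac1{\alpha-1}\log\int(\frac{d\mu}{d\nu})^\alpha d\nu$ if $\mu\ll\nu$ and $D_\alpha(\mu\|\nu)=\infty$ otherwise. Let $D_{\mathrm{TV}}(\mu,\nu)=\frac12\int|\mu(\omega)-\nu(\omega)|\,d\omega$, with $\mu(\omega),\nu(\omega)$ the densities with respect to a common dominating measure. Let $$D_{\alpha,\delta}(\mu\|\nu)=\inf\{D_\alpha(\tilde\mu\|\tilde\nu): D_{\mathrm{TV}}(\tilde\mu,\mu)\le\delta,\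 D_{\mathrm{TV}}(\tilde\nu,\nu)\le\delta\}$$ over probability measures $\tilde\mu,\tilde\nu$. **Lemma.** Let $\mathcal D,\mathcal D'\in\mathcal S^n$ differ in exactly one entry, namely the first. Fix the indices $z_{i,j}$, let $b$ be the number of pairs $(i,j)$ with $z_{i,j}=1$, and let $\mu$, $\mu'$ be the distributions of the output of the solver with these indices on $\mathcal D$ and $\mathcal D'$, respectively. Let $\delta>0$ and suppose, with $\log$ the natural logarithm and the condition being void if $T=1$, that $$\frac\rho r\ \ge\ 1728\,\log^2\!\Big(\frac{\log T}{\delta}\Big).$$ Then for every $\alpha>1$, $$D_{\alpha,\delta}(\mu\|\mu')\ \le\ 1500\,\alpha\,\beta^2b^2,$$ and there are admissible $\tilde\mu,\tilde\nu$ in the infimum with $D_\alpha(\tilde\mu\|\tilde\nu)\le1500\,\alpha\,\beta^2b^2$. -/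

import Mathlib

open MeasureTheory ProbabilityTheory
open scoped ENNReal

noncomputable section

namespace ReSQue

/-- The space `ℝ^d` with its Euclidean norm. -/
abbrev E (d : ℕ) : Type := EuclideanSpace ℝ (Fin d)

/-! ### Divergences -/

/-- Total variation distance `(1/2) ∫ |μ(ω) - ν(ω)| dω`, the densities being taken with respect to
the common dominating measure `μ + ν`. -/
def tvDist {Ω : Type*} [MeasurableSpace Ω] (μ ν : Measure Ω) : ℝ :=
  (1 / 2) * ∫ ω, |(μ.rnDeriv (μ + ν) ω).toReal - (ν.rnDeriv (μ + ν) ω).toReal| ∂(μ + ν)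

open Classical in
/-- The `α`-Rényi divergence `(1 / (α - 1)) log ∫ (dμ/dν)^α dν` with values in `[-∞, ∞]`,
equal to `∞` if `μ` is not absolutely continuous with respect to `ν`. -/
def renyiDiv {Ω : Type*} [MeasurableSpace Ω] (α : ℝ) (μ ν : Measure Ω) : EReal :=
  if μ ≪ ν then ((1 / (α - 1) : ℝ) : EReal) * ENNReal.log (∫⁻ ω, (μ.rnDeriv ν ω) ^ α ∂ν) else ⊤

/-- The approximate Rényi divergence `D_{α,δ}(μ ‖ ν)`: the infimum of `D_α(μ' ‖ ν')` over all
probability measures `μ'`, `ν'` within total variation distance `δ` of `μ`, `ν` respectively. -/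
def approxRenyiDiv {Ω : Type*} [MeasurableSpace Ω] (α δ : ℝ) (μ ν : Measure Ω) : EReal :=
  ⨅ (μ' : ProbabilityMeasure Ω) (ν' : ProbabilityMeasure Ω)
    (_ : tvDist (μ' : Measure Ω) μ ≤ δ) (_ : tvDist (ν' : Measure Ω) ν ≤ δ),
    renyiDiv α (μ' : Measure Ω) (ν' : Measure Ω)

/-! ### Subgradients, projections, Gaussians, the ReSQue estimator -/

/-- `v ∈ ∂f(x)`. -/
def IsSubgradient {d : ℕ} (f : E d → ℝ) (x v : E d) : Prop :=
  ∀ y, f x + inner ℝ v (y - x) ≤ f y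

/-- Two datasets are neighboring if they differ in exactly one entry. -/
def Neighboring {S : Type*} {n : ℕ} (D D' : Fin n → S) : Prop :=
  {i | D i ≠ D' i}.ncard = 1

/-- Euclidean projection onto the closed ball of radius `r` around `c`
(see `ballProj_mem`, `ballProj_unique`). -/
def ballProj {d : ℕ} (c : E d) (r : ℝ) (x : E d) : E d :=
  if ‖x - c‖ ≤ r then x else c + (r / ‖x - c‖) • (x - c)

theorem ballProj_mem {d : ℕ} (c : E d) {r : ℝ} (hr : 0 ≤ r) (x : E d) :
    ballProj c r x ∈ Metric.closedBall c r := by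
  unfold ballProj
  split_ifs with h
  · exact mem_closedBall_iff_norm.2 h
  · have hpos : 0 < ‖x - c‖ := lt_of_le_of_lt hr (not_le.mp h)
    rw [mem_closedBall_iff_norm, add_sub_cancel_left, norm_smul, Real.norm_eq_abs,
      abs_of_nonneg (by positivity), div_mul_cancel₀ _ hpos.ne']

/-- `ballProj c r x` is the unique point of the ball nearest to `x`: it satisfies
`‖x - ballProj c r x‖² + ‖y - ballProj c r x‖² ≤ ‖x - y‖²` for all `y` in the ball. -/
theorem ballProj_unique {d : ℕ} (c : E d) {r : ℝ} (hr : 0 ≤ r) (x y : E d)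
    (hy : y ∈ Metric.closedBall c r) :
    ‖x - ballProj c r x‖ ^ 2 + ‖y - ballProj c r x‖ ^ 2 ≤ ‖x - y‖ ^ 2 := by
  rw [mem_closedBall_iff_norm] at hy
  unfold ballProj
  split_ifs with h
  · simp [norm_sub_rev]
  · have hlt : r < ‖x - c‖ := not_le.mp h
    have hpos : 0 < ‖x - c‖ := lt_of_le_of_lt hr hlt
    set u := x - c with hu
    set w := y - c with hw
    set t := r / ‖u‖ with ht
    have h1 : x - (c + t • u) = (1 - t) • u := by
      rw [sub_smul, one_smul, hu]; abel
    have h2 : y - (c + t • u) = w - t • u := by rw [hw]; abel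
    have h3 : x - y = u - w := by rw [hu, hw]; abel
    have htr : t * ‖u‖ = r := div_mul_cancel₀ _ hpos.ne'
    have ht0 : 0 ≤ t := by positivity
    have ht1 : t ≤ 1 := (div_le_one hpos).2 hlt.le
    have hcs : inner ℝ u w ≤ ‖u‖ * ‖w‖ := real_inner_le_norm u w
    have hin : inner ℝ u w ≤ t * ‖u‖ ^ 2 := by
      calc inner ℝ u w ≤ ‖u‖ * ‖w‖ := hcs
        _ ≤ ‖u‖ * r := by gcongr
        _ = t * ‖u‖ ^ 2 := by rw [← htr]; ring
    rw [h1, h2, h3, norm_sub_sq_real u w, norm_sub_sq_real w, norm_smul, norm_smul, inner_smul_right,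
      Real.norm_eq_abs, Real.norm_eq_abs, abs_of_nonneg ht0, abs_of_nonneg (by linarith),
      real_inner_comm u w]
    nlinarith [mul_le_mul_of_nonneg_left hin (by linarith : (0 : ℝ) ≤ 1 - t)]

/-- The Gaussian measure `N(0, σ² I_d)`. -/
def gauss (d : ℕ) (σ : ℝ) : Measure (E d) :=
  multivariateGaussian 0 (σ ^ 2 • (1 : Matrix (Fin d) (Fin d) ℝ))

/-- The density `γ_ρ` of `N(0, ρ² I_d)`. -/
def gaussDensity {d : ℕ} (ρ : ℝ) (x : E d) : ℝ :=
  (2 * Real.pi * ρ ^ 2) ^ (-(d : ℝ) / 2) * Real.exp (-(1 / (2 * ρ ^ 2)) * ‖x‖ ^ 2)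

/-- The ReSQue estimator of radius `ρ` with center `xbar` at `x`, with subgradient oracle `g`
and Gaussian sample `ξ`. -/
def estimator {d : ℕ} (xbar : E d) (ρ : ℝ) (g : E d → E d) (ξ x : E d) : E d :=
  (gaussDensity ρ (x - xbar - ξ) / gaussDensity ρ ξ) • g (xbar + ξ)

/-! ### The subsampled ReSQued ERM solver -/

/-- The inputs of the solver other than the dataset: center, ball radius, convolution radius,
privacy parameter, Lipschitz constant, iteration count. -/
structure Params (d : ℕ) where
  xbar : E d
  r : ℝ
  ρ : ℝ
  β : ℝ
  L : ℝ
  T : ℕ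

namespace Params

variable {d : ℕ} (P : Params d)

/-- The number of outer iterations, `k = log₂ T̂ = ⌊log₂ T⌋` where `T̂ = 2 ^ ⌊log₂ T⌋`. -/
def k : ℕ := Nat.log 2 P.T

/-- `T_i = 2^{-i} T̂`, an integer for `1 ≤ i ≤ k`. -/
def Ti (i : ℕ) : ℕ := 2 ^ P.k / 2 ^ i

def η : ℝ := P.r / P.L * min (1 / √(P.T : ℝ)) (P.β / √(d : ℝ))

/-- `η_i = 4^{-i} η`. -/
def ηi (i : ℕ) : ℝ := P.η / 4 ^ i

/-- `σ_i = L η_i / β`. -/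
def σi (i : ℕ) : ℝ := P.L * P.ηi i / P.β

end Params

variable {d : ℕ} {S : Type*} {n : ℕ}

/-- The iterates `y_j` of the `i`-th outer loop started at `y0`, for sampled indices `z i j`
(`1 ≤ i ≤ k`, `1 ≤ j ≤ T_i`) and Gaussian samples `ξ j`. Here `g s` is the subgradient oracle of
the sampled function of `s ∈ S`, and `D` is the dataset. -/
def innerIter (P : Params d) (g : S → E d → E d) (D : Fin n → S) (z : ℕ → ℕ → Fin n) (i : ℕ)
    (y0 : E d) (ξ : ℕ → E d) : ℕ → E d
  | 0 => y0
  | j + 1 =>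
      let y := innerIter P g D z i y0 ξ j
      ballProj P.xbar P.r
        (y - P.ηi i • estimator P.xbar P.ρ (g (D (z i (j + 1)))) (ξ (j + 1)) y)

/-- The average `(1 / T_i) ∑_{1 ≤ j ≤ T_i} y_j`. -/
def innerAvg (P : Params d) (g : S → E d → E d) (D : Fin n → S) (z : ℕ → ℕ → Fin n) (i : ℕ)
    (y0 : E d) (ξ : ℕ → E d) : E d :=
  (1 / (P.Ti i : ℝ)) • ∑ j ∈ Finset.Icc 1 (P.Ti i), innerIter P g D z i y0 ξ j

/-- The law of `x_i`: given `x_{i-1}`, draw fresh independent samples `ξ_{i,j} ∼ N(0, ρ² I_d)` and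
`ζ_i ∼ N(0, σ_i² I_d)`, independent of everything before, and set `x_i = ybar_i + ζ_i`, where
`ybar_i` is the average of the iterates of the `i`-th loop started at `x_{i-1}`. -/
def outerLaw (P : Params d) (g : S → E d → E d) (D : Fin n → S) (z : ℕ → ℕ → Fin n) :
    ℕ → Measure (E d)
  | 0 => Measure.dirac P.xbar
  | i + 1 =>
      ((outerLaw P g D z i).prod
        ((Measure.infinitePi fun _ : ℕ => gauss d P.ρ).prod (gauss d (P.σi (i + 1))))).map
        fun ω => innerAvg P g D z (i + 1) ω.1 ω.2.1 + ω.2.2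

/-- The law of the output `x_k` of the solver, for a fixed realization `z` of the sampled
indices. -/
def outputLaw (P : Params d) (g : S → E d → E d) (D : Fin n → S) (z : ℕ → ℕ → Fin n) :
    Measure (E d) :=
  outerLaw P g D z P.k

/-- The number of times that `a` occurs among the sampled indices `z i j`, `1 ≤ i ≤ k`,
`1 ≤ j ≤ T_i`. -/
def occurrences (P : Params d) (z : ℕ → ℕ → Fin n) (a : Fin n) : ℕ :=
  ∑ i ∈ Finset.Icc 1 P.k, ((Finset.Icc 1 (P.Ti i)).filter fun j => z i j = a).card

end ReSQue

end

namespace ReSQue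

/-! ### Gaussian measures -/

/-! The runs on `D` and `D'` share all randomness and differ only at steps that sample entry `0`. At
any other step both use the same oracle. Such a step need not contract pathwise, because the weights
at `y` and `y'` differ, but it almost contracts in moments. A Gaussian change of variables turns the
mean estimator at `y` into `E g(y + ξ)`, a monotone field in `y`. Hence the linear term in the
expansion of `‖y - y' - A‖ ^ (2m)`, with `A` the difference of the two gradient steps, has a
favourable mean, and only a relative error of order `m² (η_i L / ρ)²` remains
(`lintegral_common_step_le`). A step that samples entry `0` adds at most `4 η_i L` to the `L^{2m}`
distance. By Markov, if loop `i` samples entry `0` exactly `b_i` times and starts within `4 m r` of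
the center, its two averages differ by at most `50 η_i L b_i`, up to probability `100^{-m}`
(`measure_innerAvg_sub_gt_le`). The start is that close up to probability `4 · 36^{-m}`
(`outerLaw_norm_gt_le`).

A high-probability bound does not bound a Rényi divergence, so the chain on `D'` is modified:
wherever the two averages are too far apart, the average on `D` is used instead. The hybrid chain is
near the true one in total variation (`tvBound_chainLaw`) and differs from the chain on `D` by a
sure bound in every loop. The Gaussian noise `ζ_i` hides this difference at cost `1250 α β² b_i²`.
The costs add up along the chain (`holderDom_chainLaw`), and `∑ b_i² ≤ b²`.

Both divergences are handled by duality, through test functions. These forms compose along Markov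
chains by Fubini, and densities appear only in the final conversion. The moment order `m` is about
`log (log T / δ)`, which makes the total failure probability at most `δ`; the condition on `ρ / r`
is what moments of that order require. -/

instance isProbabilityMeasure_gauss (d : ℕ) (σ : ℝ) : IsProbabilityMeasure (gauss d σ) := by
  unfold gauss; infer_instance

theorem gaussDensity_pos {d : ℕ} {σ : ℝ} (hσ : 0 < σ) (x : E d) : 0 < gaussDensity σ x := by
  unfold gaussDensity; positivity

theorem continuous_gaussDensity {d : ℕ} (σ : ℝ) : Continuous (gaussDensity (d := d) σ) := by
  unfold gaussDensity; fun_prop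

theorem measurable_gaussDensity {d : ℕ} (σ : ℝ) : Measurable (gaussDensity (d := d) σ) :=
  (continuous_gaussDensity σ).measurable

/-- `gauss` is defined through its covariance matrix; this Fourier transform identifies its density
by comparing characteristic functions. The case `t = 0` gives integrability of the density. -/
theorem integral_gaussDensity_mul_cexp {d : ℕ} {σ : ℝ} (hσ : 0 < σ) (t : E d) :
    Integrable (fun x : E d => (gaussDensity σ x : ℂ) * Complex.exp (inner ℝ x t * Complex.I)) ∧
    ∫ x : E d, (gaussDensity σ x : ℂ) * Complex.exp (inner ℝ x t * Complex.I) =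
      Complex.exp (-(σ ^ 2 * ‖t‖ ^ 2 / 2 : ℝ)) := by
  set b : ℂ := ((1 / (2 * σ ^ 2) : ℝ) : ℂ) with hb
  have hbpos : 0 < b.re := by rw [hb, Complex.ofReal_re]; positivity
  set c0 : ℝ := (2 * Real.pi * σ ^ 2) ^ (-(d : ℝ) / 2) with hc0
  have hfun : (fun x : E d => (gaussDensity σ x : ℂ) * Complex.exp (inner ℝ x t * Complex.I)) =
      fun x => (c0 : ℂ) * Complex.exp (-b * ‖x‖ ^ 2 + Complex.I * (inner ℝ t x : ℝ)) := by
    funext x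
    rw [Complex.exp_add, ← mul_assoc]
    unfold gaussDensity
    rw [real_inner_comm]
    congr 1
    · push_cast [hb]; rfl
    · rw [mul_comm]
  refine ⟨?_, ?_⟩
  · rw [hfun]
    exact (GaussianFourier.integrable_cexp_neg_mul_sq_norm_add hbpos _ _).const_mul _
  · rw [hfun, integral_const_mul, GaussianFourier.integral_cexp_neg_mul_sq_norm_add hbpos,
      ← mul_assoc]
    have h2 : (0 : ℝ) < 2 * Real.pi * σ ^ 2 := by positivity
    have h1 : ((Real.pi : ℂ) / b) ^ ((Module.finrank ℝ (E d) : ℂ) / 2) =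
        (((2 * Real.pi * σ ^ 2) ^ ((d : ℝ) / 2) : ℝ) : ℂ) := by
      rw [Complex.ofReal_cpow h2.le]
      have : (Real.pi : ℂ) / b = ((2 * Real.pi * σ ^ 2 : ℝ) : ℂ) := by
        rw [hb, ← Complex.ofReal_div]; congr 1; field_simp
      rw [this, finrank_euclideanSpace, Fintype.card_fin]
      push_cast; rfl
    rw [h1, ← Complex.ofReal_mul, hc0, ← Real.rpow_add h2]
    have : -(d : ℝ) / 2 + (d : ℝ) / 2 = 0 := by ring
    rw [this, Real.rpow_zero, Complex.ofReal_one, one_mul]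
    congr 1
    rw [hb, Complex.I_sq]
    have : (σ : ℂ) ≠ 0 := by exact_mod_cast hσ.ne'
    push_cast
    field_simp
    ring

theorem charFun_gauss {d : ℕ} (σ : ℝ) (t : E d) :
    charFun (gauss d σ) t = Complex.exp (-(σ ^ 2 * ‖t‖ ^ 2 / 2 : ℝ)) := by
  have hS : (σ ^ 2 • (1 : Matrix (Fin d) (Fin d) ℝ)).PosSemidef :=
    Matrix.PosSemidef.one.smul (sq_nonneg σ)
  rw [gauss, charFun_multivariateGaussian hS]
  congr 1
  have : t.ofLp ⬝ᵥ t.ofLp = ‖t‖ ^ 2 := by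
    rw [EuclideanSpace.real_norm_sq_eq]
    simp [dotProduct, sq]
  rw [Matrix.smul_mulVec, Matrix.one_mulVec, dotProduct_smul, this]
  simp

theorem gauss_eq_withDensity {d : ℕ} {σ : ℝ} (hσ : 0 < σ) :
    gauss d σ = volume.withDensity fun x => ENNReal.ofReal (gaussDensity σ x) := by
  have hint : Integrable (fun x : E d => gaussDensity σ x) := by
    have := (integral_gaussDensity_mul_cexp hσ (0 : E d)).1
    simpa using this.re
  have : IsFiniteMeasure
      ((volume : Measure (E d)).withDensity fun x => ENNReal.ofReal (gaussDensity σ x)) :=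
    isFiniteMeasure_withDensity_ofReal hint.2
  apply Measure.ext_of_charFun
  funext t
  rw [charFun_gauss, charFun_apply, integral_withDensity_eq_integral_toReal_smul
    (measurable_gaussDensity σ).ennreal_ofReal (by simp)]
  rw [← (integral_gaussDensity_mul_cexp hσ t).2]
  congr 1; funext x
  rw [ENNReal.toReal_ofReal (gaussDensity_pos hσ x).le]
  simp

/-- The density of the shifted Gaussian `N(v, ρ² I_d)` with respect to `N(0, ρ² I_d)`. -/
noncomputable def weight {d : ℕ} (ρ : ℝ) (v ξ : E d) : ℝ :=
  gaussDensity ρ (v - ξ) / gaussDensity ρ ξ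

theorem weight_eq {d : ℕ} {ρ : ℝ} (hρ : 0 < ρ) (v ξ : E d) :
    weight ρ v ξ = Real.exp ((inner ℝ v ξ - ‖v‖ ^ 2 / 2) / ρ ^ 2) := by
  unfold weight gaussDensity
  have h2 : (0 : ℝ) < 2 * Real.pi * ρ ^ 2 := by positivity
  rw [mul_div_mul_left _ _ (Real.rpow_pos_of_pos h2 _).ne', ← Real.exp_sub,
    norm_sub_sq_real]
  congr 1
  field_simp
  ring

theorem weight_pos {d : ℕ} {ρ : ℝ} (hρ : 0 < ρ) (v ξ : E d) : 0 < weight ρ v ξ := by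
  rw [weight_eq hρ]; positivity

theorem measurable_weight {d : ℕ} (ρ : ℝ) :
    Measurable fun p : E d × E d => weight ρ p.1 p.2 := by
  unfold weight
  exact ((measurable_gaussDensity ρ).comp (measurable_fst.sub measurable_snd)).div
    ((measurable_gaussDensity ρ).comp measurable_snd)

theorem measurable_weight_right {d : ℕ} (ρ : ℝ) (v : E d) : Measurable (weight ρ v) := by
  unfold weight
  exact ((measurable_gaussDensity ρ).comp (measurable_const.sub measurable_id)).div
    (measurable_gaussDensity ρ)

/-- Translation invariance of Lebesgue measure moves the shift onto the density, which is even. The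
identity serves twice: it removes the weights from the mean estimator, and it prices a shift hidden
by the noise `ζ_i`. -/
theorem lintegral_gauss_shift {d : ℕ} {σ : ℝ} (hσ : 0 < σ) (v : E d) {h : E d → ℝ≥0∞}
    (hh : Measurable h) :
    ∫⁻ ξ, h (v + ξ) ∂gauss d σ = ∫⁻ ξ, ENNReal.ofReal (weight σ v ξ) * h ξ ∂gauss d σ := by
  have hm := (measurable_gaussDensity (d := d) σ).ennreal_ofReal
  rw [gauss_eq_withDensity hσ, lintegral_withDensity_eq_lintegral_mul _ hm
    (g := fun ξ => h (v + ξ)) (hh.comp (measurable_const_add v)), lintegral_withDensity_eq_lintegral_mul _ hm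
    (g := fun ξ => ENNReal.ofReal (weight σ v ξ) * h ξ)
    ((measurable_weight_right σ v).ennreal_ofReal.mul hh),
    ← lintegral_add_left_eq_self (μ := (volume : Measure (E d))) _ (-v)]
  refine lintegral_congr fun x => ?_
  simp only [Pi.mul_apply]
  rw [← mul_assoc, ← ENNReal.ofReal_mul (gaussDensity_pos hσ x).le, weight,
    mul_div_cancel₀ _ (gaussDensity_pos hσ x).ne', add_neg_cancel_left]
  congr 2
  unfold gaussDensity
  rw [← norm_neg (-v + x)]
  congr 4; abel_nf

theorem map_const_add_gauss {d : ℕ} {σ : ℝ} (hσ : 0 < σ) (v : E d) :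
    (gauss d σ).map (fun ξ => v + ξ) =
      (gauss d σ).withDensity fun ξ => ENNReal.ofReal (weight σ v ξ) := by
  refine Measure.ext_of_lintegral _ fun h hh => ?_
  rw [lintegral_map hh (measurable_const_add v), lintegral_gauss_shift hσ v hh,
    lintegral_withDensity_eq_lintegral_mul _ (measurable_weight_right σ v).ennreal_ofReal hh]
  rfl

theorem integral_gauss_shift {d : ℕ} {σ : ℝ} (hσ : 0 < σ) (v : E d) {h : E d → ℝ}
    (hh : Measurable h) :
    ∫ ξ, h (v + ξ) ∂gauss d σ = ∫ ξ, weight σ v ξ * h ξ ∂gauss d σ := by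
  rw [← integral_map (measurable_const_add v).aemeasurable hh.aestronglyMeasurable,
    map_const_add_gauss hσ, integral_withDensity_eq_integral_toReal_smul
      (measurable_weight_right σ v).ennreal_ofReal (by simp)]
  congr 1; funext ξ
  rw [ENNReal.toReal_ofReal (weight_pos hσ v ξ).le, smul_eq_mul]

theorem lintegral_weight {d : ℕ} {σ : ℝ} (hσ : 0 < σ) (v : E d) :
    ∫⁻ ξ, ENNReal.ofReal (weight σ v ξ) ∂gauss d σ = 1 := by
  have := lintegral_gauss_shift hσ v (h := fun _ => 1) measurable_const
  simpa using this.symm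

theorem integrable_weight {d : ℕ} {σ : ℝ} (hσ : 0 < σ) (v : E d) :
    Integrable (weight σ v) (gauss d σ) := by
  refine ⟨(measurable_weight_right σ v).aestronglyMeasurable, ?_⟩
  rw [hasFiniteIntegral_iff_ofReal (ae_of_all _ fun ξ => (weight_pos hσ v ξ).le),
    lintegral_weight hσ]
  simp

theorem lintegral_exp_inner {d : ℕ} {σ : ℝ} (hσ : 0 < σ) (a : E d) :
    ∫⁻ ξ, ENNReal.ofReal (Real.exp (inner ℝ a ξ)) ∂gauss d σ =
      ENNReal.ofReal (Real.exp (σ ^ 2 * ‖a‖ ^ 2 / 2)) := by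
  have h := lintegral_weight hσ (σ ^ 2 • a)
  have heq : ∀ ξ : E d, ENNReal.ofReal (Real.exp (inner ℝ a ξ)) =
      ENNReal.ofReal (Real.exp (σ ^ 2 * ‖a‖ ^ 2 / 2)) *
        ENNReal.ofReal (weight σ (σ ^ 2 • a) ξ) := fun ξ => by
    rw [← ENNReal.ofReal_mul (Real.exp_pos _).le, weight_eq hσ, ← Real.exp_add, norm_smul,
      real_inner_smul_left, Real.norm_eq_abs, abs_of_nonneg (sq_nonneg σ)]
    congr 2; field_simp; ring
  simp_rw [heq]
  rw [lintegral_const_mul _ (measurable_weight_right σ _).ennreal_ofReal, h, mul_one]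

theorem lintegral_exp_abs_inner_le {d : ℕ} {σ : ℝ} (hσ : 0 < σ) (a : E d) {s : ℝ}
    (hs : σ * ‖a‖ ≤ s) :
    ∫⁻ ξ, ENNReal.ofReal (Real.exp |inner ℝ a ξ|) ∂gauss d σ ≤
      ENNReal.ofReal (2 * Real.exp (s ^ 2 / 2)) := by
  have h1 : ∀ b : E d, ‖b‖ = ‖a‖ → ∫⁻ ξ, ENNReal.ofReal (Real.exp (inner ℝ b ξ)) ∂gauss d σ ≤
      ENNReal.ofReal (Real.exp (s ^ 2 / 2)) := fun b hb => by
    rw [lintegral_exp_inner hσ, hb]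
    refine ENNReal.ofReal_le_ofReal (Real.exp_le_exp.2 ?_)
    rw [← mul_pow]
    gcongr
  calc ∫⁻ ξ, ENNReal.ofReal (Real.exp |inner ℝ a ξ|) ∂gauss d σ
      ≤ ∫⁻ ξ, (ENNReal.ofReal (Real.exp (inner ℝ a ξ)) +
          ENNReal.ofReal (Real.exp (inner ℝ (-a) ξ))) ∂gauss d σ := by
        refine lintegral_mono fun ξ => ?_
        rw [inner_neg_left]
        rcases abs_cases (inner ℝ a ξ) with h | h <;> rw [h.1]
        · exact le_self_add
        · exact le_add_self
    _ = _ := lintegral_add_left (by fun_prop) _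
    _ ≤ ENNReal.ofReal (Real.exp (s ^ 2 / 2)) + ENNReal.ofReal (Real.exp (s ^ 2 / 2)) :=
        add_le_add (h1 a rfl) (h1 (-a) (norm_neg a))
    _ = _ := by rw [← ENNReal.ofReal_add (by positivity) (by positivity), two_mul]

theorem lintegral_weight_pow {d : ℕ} {σ : ℝ} (hσ : 0 < σ) (v : E d) {p : ℝ} (hp : 0 ≤ p) :
    ∫⁻ ξ, ENNReal.ofReal (weight σ v ξ) ^ p ∂gauss d σ =
      ENNReal.ofReal (Real.exp (p * (p - 1) * ‖v‖ ^ 2 / (2 * σ ^ 2))) := by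
  have heq : ∀ ξ : E d, ENNReal.ofReal (weight σ v ξ) ^ p =
      ENNReal.ofReal (Real.exp (-(p * ‖v‖ ^ 2 / (2 * σ ^ 2)))) *
        ENNReal.ofReal (Real.exp (inner ℝ ((p / σ ^ 2) • v) ξ)) := fun ξ => by
    rw [ENNReal.ofReal_rpow_of_nonneg (weight_pos hσ v ξ).le hp, weight_eq hσ,
      ← Real.exp_mul, ← ENNReal.ofReal_mul (Real.exp_pos _).le, ← Real.exp_add,
      real_inner_smul_left]
    congr 2; field_simp; ring
  simp_rw [heq]
  rw [lintegral_const_mul _ (by fun_prop), lintegral_exp_inner hσ,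
    ← ENNReal.ofReal_mul (Real.exp_pos _).le, ← Real.exp_add, norm_smul, Real.norm_eq_abs,
    mul_pow, sq_abs]
  congr 2; field_simp; ring

/-! ### Dual forms of the divergences -/

/-- The dual formulation of `D_α(μ ‖ ν) ≤ ε`, where `q` is the exponent conjugate to `α`. -/
def HolderDom {Ω : Type*} [MeasurableSpace Ω] (q ε : ℝ) (μ ν : Measure Ω) : Prop :=
  ∀ u : Ω → ℝ≥0∞, Measurable u →
    ∫⁻ x, u x ∂μ ≤ ENNReal.ofReal (Real.exp (ε / q)) * (∫⁻ x, u x ^ q ∂ν) ^ (1 / q)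

/-- The dual formulation of `D_TV(μ, ν) ≤ e`. -/
def TVBound {Ω : Type*} [MeasurableSpace Ω] (e : ℝ≥0∞) (μ ν : Measure Ω) : Prop :=
  ∀ u : Ω → ℝ≥0∞, Measurable u → (∀ x, u x ≤ 1) → ∫⁻ x, u x ∂μ ≤ ∫⁻ x, u x ∂ν + e

section Divergences

variable {Ω Ω' : Type*} [MeasurableSpace Ω] [MeasurableSpace Ω'] {α q ε : ℝ} {μ ν : Measure Ω}

theorem HolderDom.refl (hq : α.HolderConjugate q) (μ : Measure Ω) [IsProbabilityMeasure μ] :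
    HolderDom q 0 μ μ := by
  intro u hu
  have h := ENNReal.lintegral_mul_le_Lp_mul_Lq μ hq.symm hu.aemeasurable
    (aemeasurable_const (b := (1 : ℝ≥0∞)))
  simpa using h

theorem HolderDom.mono {ε' : ℝ} (h : HolderDom q ε μ ν) (hq : 0 < q) (hε : ε ≤ ε') :
    HolderDom q ε' μ ν := by
  intro u hu
  refine (h u hu).trans ?_
  gcongr

/-- Fresh randomness common to both sides costs nothing: over the probability measure `κ` the `L¹`
norm is at most the `L^q` norm, and the hypothesis applies to the partial `L^q` norm of `u`. -/
theorem HolderDom.prod (h : HolderDom q ε μ ν) (hq : α.HolderConjugate q) [SFinite μ] [SFinite ν]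
    (κ : Measure Ω') [IsProbabilityMeasure κ] : HolderDom q ε (μ.prod κ) (ν.prod κ) := by
  intro u hu
  rw [lintegral_prod _ hu.aemeasurable, lintegral_prod _ (hu.pow_const q).aemeasurable]
  have h1 : ∀ x, ∫⁻ y, u (x, y) ∂κ ≤ (∫⁻ y, u (x, y) ^ q ∂κ) ^ (1 / q) := fun x => by
    simpa using HolderDom.refl hq κ (fun y => u (x, y)) (hu.comp measurable_prodMk_left)
  refine (lintegral_mono h1).trans ?_
  refine (h _ ((hu.pow_const q).lintegral_prod_right'.pow_const _)).trans ?_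
  simp_rw [← ENNReal.rpow_mul, one_div_mul_cancel hq.symm.pos.ne', ENNReal.rpow_one]
  exact le_rfl

/-- Hölder's inequality against the density of the shift by `a - b`, whose `L^α` norm is `exp ((α -
1) ‖a - b‖² / (2σ²))`; the exponents match because `α / q = α - 1`. -/
theorem lintegral_add_gauss_le {d : ℕ} {σ : ℝ} (hσ : 0 < σ) (hq : α.HolderConjugate q) {Δ : ℝ}
    {a b : E d} (hab : ‖a - b‖ ≤ Δ) {u : E d → ℝ≥0∞} (hu : Measurable u) :
    ∫⁻ ζ, u (a + ζ) ∂gauss d σ ≤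
      ENNReal.ofReal (Real.exp (α * Δ ^ 2 / (2 * σ ^ 2) / q)) *
        (∫⁻ ζ, u (b + ζ) ^ q ∂gauss d σ) ^ (1 / q) := by
  have h1 : ∀ ζ, u (a + ζ) = u (b + ((a - b) + ζ)) := fun ζ => by congr 1; abel
  simp_rw [h1]
  have hub : Measurable fun ζ => u (b + ζ) := hu.comp (measurable_const_add b)
  rw [lintegral_gauss_shift hσ (a - b) hub]
  refine (ENNReal.lintegral_mul_le_Lp_mul_Lq _ hq
    (measurable_weight_right σ (a - b)).ennreal_ofReal.aemeasurable hub.aemeasurable).trans ?_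
  gcongr
  rw [lintegral_weight_pow hσ _ hq.pos.le, ENNReal.ofReal_rpow_of_pos (Real.exp_pos _),
    ← Real.exp_mul]
  refine ENNReal.ofReal_le_ofReal (Real.exp_le_exp.2 ?_)
  have hα := hq.pos
  have h2 : α / q = α - 1 := hq.div_conj_eq_sub_one
  have h3 : α * Δ ^ 2 / (2 * σ ^ 2) / q = (α - 1) * Δ ^ 2 / (2 * σ ^ 2) := by
    rw [← h2]; ring
  have h4 : α * (α - 1) * ‖a - b‖ ^ 2 / (2 * σ ^ 2) * (1 / α) =
      (α - 1) * ‖a - b‖ ^ 2 / (2 * σ ^ 2) := by field_simp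
  rw [h3, h4]
  have := hq.sub_one_pos
  gcongr

/-- Adaptive composition: given `x`, the Gaussian shift costs `α Δ² / (2σ²)`, and what is left is a
function of `x` alone, to which the hypothesis applies. Hence the exponents add. -/
theorem HolderDom.add_gauss {d : ℕ} {σ : ℝ} (hσ : 0 < σ) (h : HolderDom q ε μ ν)
    (hq : α.HolderConjugate q) [SFinite μ] [SFinite ν] {Δ : ℝ} {F F' : Ω → E d}
    (hF : Measurable F) (hF' : Measurable F') (hΔ : ∀ x, ‖F x - F' x‖ ≤ Δ) :
    HolderDom q (ε + α * Δ ^ 2 / (2 * σ ^ 2))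
      ((μ.prod (gauss d σ)).map fun p => F p.1 + p.2)
      ((ν.prod (gauss d σ)).map fun p => F' p.1 + p.2) := by
  intro u hu
  have hm : Measurable fun p : Ω × E d => F p.1 + p.2 := by fun_prop
  have hm' : Measurable fun p : Ω × E d => F' p.1 + p.2 := by fun_prop
  have hum : Measurable fun p : Ω × E d => u (F p.1 + p.2) := hu.comp hm
  have hum' : Measurable fun p : Ω × E d => u (F' p.1 + p.2) ^ q := (hu.comp hm').pow_const q
  rw [lintegral_map hu hm, lintegral_map (hu.pow_const q) hm',
    lintegral_prod _ hum.aemeasurable, lintegral_prod _ hum'.aemeasurable]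
  refine (lintegral_mono fun x => lintegral_add_gauss_le hσ hq (hΔ x) hu).trans ?_
  have hv : Measurable fun x => ∫⁻ ζ, u (F' x + ζ) ^ q ∂gauss d σ :=
    hum'.lintegral_prod_right'
  rw [lintegral_const_mul _ (hv.pow_const _), add_div, Real.exp_add, mul_comm (Real.exp (ε / q)),
    ENNReal.ofReal_mul (Real.exp_pos _).le, mul_assoc]
  gcongr
  refine (h _ (hv.pow_const _)).trans ?_
  simp_rw [← ENNReal.rpow_mul, one_div_mul_cancel hq.symm.pos.ne', ENNReal.rpow_one]
  exact le_rfl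

theorem HolderDom.absolutelyContinuous (h : HolderDom q ε μ ν) (hq : 0 < q) : μ ≪ ν := by
  refine Measure.AbsolutelyContinuous.mk fun s hs h0 => ?_
  have h1 := h (s.indicator 1) (measurable_one.indicator hs)
  have h2 : ∀ x, (s.indicator (1 : Ω → ℝ≥0∞) x) ^ q = s.indicator 1 x := fun x => by
    by_cases hx : x ∈ s <;> simp [hx, hq]
  simp_rw [h2] at h1
  rw [lintegral_indicator_one hs, lintegral_indicator_one hs, h0,
    ENNReal.zero_rpow_of_pos (by positivity), mul_zero] at h1
  exact le_antisymm h1 bot_le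

/-- The extremal test function is `f ^ (α - 1)` with `f = dμ/dν`. It yields `I ≤ exp (ε / q) * I ^
(1 / q)` for `I = ∫ f ^ α dν`, which is solved for `I`. The division needs `I` finite, hence the
truncation of `f` at `N` and the monotone limit. -/
theorem HolderDom.lintegral_rnDeriv_rpow_le [IsProbabilityMeasure μ] [IsProbabilityMeasure ν]
    (h : HolderDom q ε μ ν) (hq : α.HolderConjugate q) :
    ∫⁻ x, μ.rnDeriv ν x ^ α ∂ν ≤ ENNReal.ofReal (Real.exp (ε * (α - 1))) := by
  have hac := h.absolutelyContinuous hq.symm.pos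
  set f := μ.rnDeriv ν with hf
  have hfm : Measurable f := Measure.measurable_rnDeriv μ ν
  have hα := hq.pos
  have hα1 := hq.sub_one_pos
  have hmeas : ∀ N : ℕ, Measurable fun x => min (f x) (N : ℝ≥0∞) := fun N =>
    hfm.min measurable_const
  have hbound : ∀ N : ℕ, ∫⁻ x, min (f x) (N : ℝ≥0∞) ^ α ∂ν ≤
      ENNReal.ofReal (Real.exp (ε * (α - 1))) := fun N => by
    set I := ∫⁻ x, min (f x) (N : ℝ≥0∞) ^ α ∂ν with hI
    have hItop : I ≠ ⊤ := by
      refine ne_top_of_le_ne_top (b := (N : ℝ≥0∞) ^ α)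
        (ENNReal.rpow_ne_top_of_nonneg hα.le (ENNReal.natCast_ne_top N)) ?_
      calc I ≤ ∫⁻ _, (N : ℝ≥0∞) ^ α ∂ν := by
            refine lintegral_mono fun x => ?_
            gcongr
            exact min_le_right _ _
        _ = _ := by simp
    have h1 := h (fun x => min (f x) (N : ℝ≥0∞) ^ (α - 1)) ((hmeas N).pow_const _)
    simp_rw [← ENNReal.rpow_mul] at h1
    have hexp : (α - 1) * q = α := hq.sub_one_mul_conj
    rw [hexp, ← hI] at h1
    have h2 : I ≤ ∫⁻ x, min (f x) (N : ℝ≥0∞) ^ (α - 1) ∂μ := by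
      rw [← Measure.withDensity_rnDeriv_eq μ ν hac, lintegral_withDensity_eq_lintegral_mul _ hfm
        ((hmeas N).pow_const _)]
      refine lintegral_mono fun x => ?_
      have : min (f x) (N : ℝ≥0∞) ^ α = min (f x) (N : ℝ≥0∞) * min (f x) (N : ℝ≥0∞) ^ (α - 1) := by
        conv_lhs => rw [show α = 1 + (α - 1) by ring]
        rw [ENNReal.rpow_add_of_nonneg _ _ zero_le_one hα1.le, ENNReal.rpow_one]
      rw [this]
      simp only [Pi.mul_apply]
      gcongr
      exact min_le_left _ _
    have h3 := h2.trans h1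
    by_cases hI0 : I = 0
    · rw [hI0]; exact bot_le
    have hq1 : 1 / q = 1 - 1 / α := by
      rw [one_div, one_div]; exact hq.symm.one_sub_inv.symm ▸ (by ring)
    have h4 : I ^ (1 / α) ≤ ENNReal.ofReal (Real.exp (ε / q)) := by
      have hsplit : I = I ^ (1 / α) * I ^ (1 / q) := by
        rw [← ENNReal.rpow_add _ _ hI0 hItop, hq1]
        simp
      have hne0 : I ^ (1 / q) ≠ 0 := by
        simp [ENNReal.rpow_eq_zero_iff, hI0, hItop]
      have hnetop : I ^ (1 / q) ≠ ⊤ :=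
        ENNReal.rpow_ne_top_of_nonneg (by have := hq.symm.pos; positivity) hItop
      rw [← ENNReal.mul_le_mul_iff_left hne0 hnetop, ← hsplit]
      exact h3
    calc I = (I ^ (1 / α)) ^ α := by
          rw [← ENNReal.rpow_mul, one_div_mul_cancel hα.ne', ENNReal.rpow_one]
      _ ≤ ENNReal.ofReal (Real.exp (ε / q)) ^ α := by gcongr
      _ = _ := by
          rw [ENNReal.ofReal_rpow_of_pos (Real.exp_pos _), ← Real.exp_mul,
            ← hq.div_conj_eq_sub_one]
          congr 2; ring
  have hlim : Filter.Tendsto (fun N : ℕ => ∫⁻ x, min (f x) (N : ℝ≥0∞) ^ α ∂ν) Filter.atTop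
      (nhds (∫⁻ x, f x ^ α ∂ν)) := by
    refine lintegral_tendsto_of_tendsto_of_monotone
      (fun N => ((hmeas N).pow_const α).aemeasurable) ?_ ?_
    · refine ae_of_all _ fun x N M hNM => ?_
      dsimp only
      gcongr
    · refine ae_of_all _ fun x => ?_
      have h1 : Filter.Tendsto (fun N : ℕ => min (f x) (N : ℝ≥0∞)) Filter.atTop
          (nhds (min (f x) ⊤)) := tendsto_const_nhds.min ENNReal.tendsto_nat_nhds_top
      rw [min_top_right] at h1
      exact (ENNReal.continuous_rpow_const.tendsto _).comp h1
  exact le_of_tendsto' hlim hbound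

theorem HolderDom.renyiDiv_le [IsProbabilityMeasure μ] [IsProbabilityMeasure ν]
    (h : HolderDom q ε μ ν) (hq : α.HolderConjugate q) : renyiDiv α μ ν ≤ (ε : EReal) := by
  rw [renyiDiv, if_pos (h.absolutelyContinuous hq.symm.pos)]
  have h1 := ENNReal.log_monotone (h.lintegral_rnDeriv_rpow_le hq)
  rw [← EReal.exp_coe, EReal.log_exp] at h1
  have hα1 := hq.sub_one_pos
  have h2 : (0 : EReal) ≤ ((1 / (α - 1) : ℝ) : EReal) := by
    exact_mod_cast (by positivity : (0 : ℝ) ≤ 1 / (α - 1))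
  refine (mul_le_mul_of_nonneg_left h1 h2).trans ?_
  rw [← EReal.coe_mul]
  refine le_of_eq ?_
  congr 1
  field_simp

/-! ### Total variation through bounded test functions. -/

theorem TVBound.refl (μ : Measure Ω) : TVBound 0 μ μ := fun u _ _ => by simp

theorem TVBound.mono {e e' : ℝ≥0∞} (h : TVBound e μ ν) (he : e ≤ e') : TVBound e' μ ν :=
  fun u hu hu1 => (h u hu hu1).trans (by gcongr)

/-- A one-sided bound suffices: the total masses agree, so half the `L¹` distance of the densities
is `μ A - ν A` on the set `A` where the density of `μ` dominates. -/
theorem TVBound.tvDist_le [IsProbabilityMeasure μ] [IsProbabilityMeasure ν] {δ : ℝ} (hδ : 0 ≤ δ)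
    (h : TVBound (ENNReal.ofReal δ) μ ν) : tvDist μ ν ≤ δ := by
  have hset : ∀ A, MeasurableSet A → μ.real A ≤ ν.real A + δ := fun A hA => by
    have h1 := h (A.indicator 1) (measurable_one.indicator hA)
      (fun x => Set.indicator_le_self' (by simp) x)
    rw [lintegral_indicator_one hA, lintegral_indicator_one hA] at h1
    have h2 := ENNReal.toReal_mono (by finiteness) h1
    rwa [ENNReal.toReal_add (by finiteness) (by finiteness), ENNReal.toReal_ofReal hδ] at h2
  have hμ : μ ≪ μ + ν := Measure.absolutelyContinuous_of_le (Measure.le_add_right le_rfl)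
  have hν : ν ≪ μ + ν := Measure.absolutelyContinuous_of_le (Measure.le_add_left le_rfl)
  set f := fun ω => (μ.rnDeriv (μ + ν) ω).toReal
  set g := fun ω => (ν.rnDeriv (μ + ν) ω).toReal
  have hf : Integrable f (μ + ν) := Measure.integrable_toReal_rnDeriv
  have hg : Integrable g (μ + ν) := Measure.integrable_toReal_rnDeriv
  have hfm : Measurable f := (Measure.measurable_rnDeriv _ _).ennreal_toReal
  have hgm : Measurable g := (Measure.measurable_rnDeriv _ _).ennreal_toReal
  have hA : MeasurableSet {ω | g ω ≤ f ω} := measurableSet_le hgm hfm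
  set A := {ω | g ω ≤ f ω}
  have hfA : ∀ B, ∫ ω in B, f ω ∂(μ + ν) = μ.real B := fun B =>
    Measure.setIntegral_toReal_rnDeriv hμ B
  have hgA : ∀ B, ∫ ω in B, g ω ∂(μ + ν) = ν.real B := fun B =>
    Measure.setIntegral_toReal_rnDeriv hν B
  have h1 : ∫ ω in A, |f ω - g ω| ∂(μ + ν) = μ.real A - ν.real A := by
    rw [← hfA, ← hgA, ← integral_sub hf.integrableOn hg.integrableOn]
    exact setIntegral_congr_fun hA fun ω hω => abs_of_nonneg (sub_nonneg.2 hω)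
  have h2 : ∫ ω in Aᶜ, |f ω - g ω| ∂(μ + ν) = ν.real Aᶜ - μ.real Aᶜ := by
    rw [← hfA, ← hgA, ← integral_sub hg.integrableOn hf.integrableOn]
    refine setIntegral_congr_fun hA.compl fun ω hω => ?_
    have : f ω < g ω := not_le.1 hω
    rw [abs_of_neg (by linarith)]; ring
  have h3 : tvDist μ ν = 1 / 2 * ∫ ω, |f ω - g ω| ∂(μ + ν) := rfl
  rw [h3, ← integral_add_compl hA (f := fun ω => |f ω - g ω|) (hf.sub hg).abs, h1, h2, probReal_compl_eq_one_sub hA,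
    probReal_compl_eq_one_sub hA]
  linarith [hset A hA]

end Divergences

/-! ### Moment contraction of a common gradient step -/

/-- The linear term is kept exactly, because later the sign of its mean is used. The induction
closes by `m + m² ≤ (m + 1)²`. -/
theorem one_add_pow_le_quadratic {Y : ℝ} (hY : -1 ≤ Y) (m : ℕ) :
    (1 + Y) ^ m ≤ 1 + m * Y + m ^ 2 * Y ^ 2 * (1 + |Y|) ^ m := by
  induction m with
  | zero => simp
  | succ m ih =>
    have h0 : 0 ≤ 1 + Y := by linarith
    have h1 : 1 + Y ≤ 1 + |Y| := by linarith [le_abs_self Y]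
    have h2 : 1 ≤ (1 + |Y|) ^ (m + 1) := one_le_pow₀ (by linarith [abs_nonneg Y])
    have h3 : (m : ℝ) * Y ^ 2 ≤ m * Y ^ 2 * (1 + |Y|) ^ (m + 1) :=
      le_mul_of_one_le_right (by positivity) h2
    have h4 : (m : ℝ) ^ 2 * Y ^ 2 * (1 + |Y|) ^ m * (1 + Y) ≤
        m ^ 2 * Y ^ 2 * (1 + |Y|) ^ (m + 1) := by
      rw [pow_succ _ m, ← mul_assoc]
      gcongr
    have h5 : ((m : ℝ) + m ^ 2) * (Y ^ 2 * (1 + |Y|) ^ (m + 1)) ≤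
        (m + 1) ^ 2 * (Y ^ 2 * (1 + |Y|) ^ (m + 1)) := by
      gcongr
      nlinarith [(Nat.cast_nonneg m : (0 : ℝ) ≤ m)]
    have h6 := mul_le_mul_of_nonneg_right ih h0
    rw [pow_succ]
    push_cast
    nlinarith

/-- With `N` the normalised inner product and `t = ‖A‖ / ‖Δ‖`, one has `‖Δ - A‖² = ‖Δ‖² (1 + Y)` for
`Y = -2N + t²`. In the constant `5`, the term `m t²` accounts for `1` and the quadratic remainder,
through `Y² ≤ 4 D² (1 + D)²`, for `4`. -/
theorem norm_sub_pow_le {d : ℕ} {Δ A : E d} (hΔ : Δ ≠ 0) {D : ℝ} (hA : ‖A‖ ≤ D * ‖Δ‖) (m : ℕ) :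
    ‖Δ - A‖ ^ (2 * m) ≤ ‖Δ‖ ^ (2 * m) *
      (1 - 2 * m * (inner ℝ Δ A / ‖Δ‖ ^ 2) + 5 * m ^ 2 * (D ^ 2 * (1 + D) ^ (2 * m + 2))) := by
  have hφ : 0 < ‖Δ‖ := norm_pos_iff.2 hΔ
  set φ := ‖Δ‖ with hφdef
  set N := inner ℝ Δ A / φ ^ 2 with hN
  set t := ‖A‖ / φ with ht
  have ht0 : 0 ≤ t := by positivity
  have htD : t ≤ D := (div_le_iff₀ hφ).2 hA
  have hD0 : 0 ≤ D := ht0.trans htD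
  have hNt : |N| ≤ t := by
    rw [hN, abs_div, abs_of_pos (by positivity : 0 < φ ^ 2), div_le_iff₀ (by positivity)]
    have := abs_real_inner_le_norm Δ A
    have e : t * φ ^ 2 = φ * ‖A‖ := by rw [ht]; field_simp
    rw [e]; exact this
  have hsq : ‖Δ - A‖ ^ 2 = φ ^ 2 * (1 + (-2 * N + t ^ 2)) := by
    rw [norm_sub_sq_real, hN, ht]; field_simp; ring
  set Y := -2 * N + t ^ 2 with hYdef
  have hY1 : -1 ≤ Y := by
    have : 0 ≤ φ ^ 2 * (1 + Y) := hsq ▸ sq_nonneg _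
    have := nonneg_of_mul_nonneg_right this (by positivity)
    linarith
  have hYabs : |Y| ≤ 2 * D + D ^ 2 := by
    obtain ⟨h1, h2⟩ := abs_le.1 hNt
    have : t ^ 2 ≤ D ^ 2 := by gcongr
    rw [abs_le]; constructor <;> nlinarith
  have hY2 : Y ^ 2 ≤ 4 * D ^ 2 * (1 + D) ^ 2 := by
    rw [← sq_abs]
    calc |Y| ^ 2 ≤ (2 * D + D ^ 2) ^ 2 := by gcongr
      _ ≤ (2 * D * (1 + D)) ^ 2 := by gcongr; nlinarith
      _ = _ := by ring
  have h1Y : (1 + |Y|) ^ m ≤ (1 + D) ^ (2 * m) := by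
    rw [pow_mul]; gcongr; nlinarith
  rw [pow_mul, hsq, mul_pow, ← pow_mul]
  gcongr
  refine (one_add_pow_le_quadratic hY1 m).trans ?_
  have hm : (m : ℝ) ≤ m ^ 2 := by exact_mod_cast Nat.le_self_pow two_ne_zero m
  have hbig : 1 ≤ (1 + D) ^ (2 * m + 2) := one_le_pow₀ (by linarith)
  have h2 : (m : ℝ) * t ^ 2 ≤ m ^ 2 * (D ^ 2 * (1 + D) ^ (2 * m + 2)) := by
    have : t ^ 2 ≤ D ^ 2 := by gcongr
    calc (m : ℝ) * t ^ 2 ≤ m ^ 2 * D ^ 2 := by gcongr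
      _ ≤ _ := by
        rw [← mul_assoc]
        exact le_mul_of_one_le_right (by positivity) hbig
  have h3 : (m : ℝ) ^ 2 * Y ^ 2 * (1 + |Y|) ^ m ≤
      4 * m ^ 2 * (D ^ 2 * (1 + D) ^ (2 * m + 2)) := by
    calc (m : ℝ) ^ 2 * Y ^ 2 * (1 + |Y|) ^ m
        ≤ m ^ 2 * (4 * D ^ 2 * (1 + D) ^ 2) * (1 + D) ^ (2 * m) := by gcongr
      _ = _ := by ring
  rw [hYdef] at *
  nlinarith

theorem abs_exp_sub_exp_le (x y : ℝ) {c : ℝ} (hx : x ≤ c) (hy : y ≤ c) :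
    |Real.exp x - Real.exp y| ≤ |x - y| * Real.exp c := by
  wlog h : y ≤ x generalizing x y
  · rw [abs_sub_comm, abs_sub_comm x]
    exact this y x hy hx (le_of_not_ge h)
  rw [abs_of_nonneg (sub_nonneg.2 (Real.exp_le_exp.2 h)), abs_of_nonneg (sub_nonneg.2 h)]
  have h1 : Real.exp y = Real.exp x * Real.exp (y - x) := by rw [← Real.exp_add]; ring_nf
  have h2 := Real.add_one_le_exp (y - x)
  calc Real.exp x - Real.exp y ≤ (x - y) * Real.exp x := by
        rw [h1]; nlinarith [Real.exp_pos x]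
    _ ≤ _ := by gcongr

/-- A mean value bound for the exponential. The sample `ξ` enters only through inner products with
`v`, `v'` and `v - v'`, which keeps later integrals free of the dimension. -/
theorem abs_weight_sub_le {d : ℕ} {ρ R : ℝ} (hρ : 0 < ρ) {v v' : E d} (hv : ‖v‖ ≤ R)
    (hv' : ‖v'‖ ≤ R) (ξ : E d) :
    |weight ρ v ξ - weight ρ v' ξ| ≤ (|inner ℝ (v - v') ξ| + R * ‖v - v'‖) / ρ ^ 2 *
      Real.exp ((|inner ℝ v ξ| + |inner ℝ v' ξ|) / ρ ^ 2) := by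
  rw [weight_eq hρ, weight_eq hρ]
  refine (abs_exp_sub_exp_le (c := (|inner ℝ v ξ| + |inner ℝ v' ξ|) / ρ ^ 2) _ _ ?_ ?_).trans ?_
  · gcongr
    linarith [le_abs_self (inner ℝ v ξ), abs_nonneg (inner ℝ v' ξ), sq_nonneg ‖v‖]
  · gcongr
    linarith [le_abs_self (inner ℝ v' ξ), abs_nonneg (inner ℝ v ξ), sq_nonneg ‖v'‖]
  · gcongr
    rw [← sub_div, abs_div, abs_of_pos (by positivity : 0 < ρ ^ 2)]
    gcongr
    have h1 : inner ℝ v ξ - ‖v‖ ^ 2 / 2 - (inner ℝ v' ξ - ‖v'‖ ^ 2 / 2) =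
        inner ℝ (v - v') ξ - (‖v‖ ^ 2 - ‖v'‖ ^ 2) / 2 := by rw [inner_sub_left]; ring
    rw [h1]
    refine (abs_sub _ _).trans ?_
    gcongr
    have h2 : (‖v‖ ^ 2 - ‖v'‖ ^ 2) / 2 = (‖v‖ + ‖v'‖) / 2 * (‖v‖ - ‖v'‖) := by ring
    rw [h2, abs_mul, abs_of_nonneg (by positivity)]
    exact mul_le_mul (by linarith) (abs_norm_sub_norm_le v v') (abs_nonneg _)
      ((norm_nonneg v).trans hv)

/-- The exponent is the convex combination of `3a/2`, `12c` and `12c'` with weights `5/6`, `1/12`,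
`1/12`, hence at most their maximum. -/
theorem exp_combination_le (a c c' : ℝ) :
    Real.exp (5 / 4 * a + c + c') ≤
      Real.exp (3 / 2 * a) + Real.exp (12 * c) + Real.exp (12 * c') := by
  have h1 := Real.exp_pos (3 / 2 * a)
  have h2 := Real.exp_pos (12 * c)
  have h3 := Real.exp_pos (12 * c')
  rcases le_total (3 / 2 * a) (12 * c) with h | h <;> rcases le_total (12 * c) (12 * c') with h' | h'
  · have : Real.exp (5 / 4 * a + c + c') ≤ Real.exp (12 * c') := Real.exp_le_exp.2 (by linarith)
    linarith
  · have : Real.exp (5 / 4 * a + c + c') ≤ Real.exp (12 * c) := Real.exp_le_exp.2 (by linarith)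
    linarith
  · rcases le_total (3 / 2 * a) (12 * c') with h'' | h''
    · have : Real.exp (5 / 4 * a + c + c') ≤ Real.exp (12 * c') := Real.exp_le_exp.2 (by linarith)
      linarith
    · have : Real.exp (5 / 4 * a + c + c') ≤ Real.exp (3 / 2 * a) :=
        Real.exp_le_exp.2 (by linarith)
      linarith
  · have : Real.exp (5 / 4 * a + c + c') ≤ Real.exp (3 / 2 * a) := Real.exp_le_exp.2 (by linarith)
    linarith

/-- Combines `1 + D ≤ exp (κ s + γ)` with `s² ≤ 2 exp s`. The condition on `κ` keeps the coefficient
of `s` at `1 + 1/4`, whatever `m` is. -/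
theorem sq_mul_one_add_pow_le_exp {κ s γ D : ℝ} (m : ℕ) (hκ : 0 ≤ κ)
    (hκm : κ * (2 * m + 2) ≤ 1 / 4) (hs : 0 ≤ s) (hγ : 0 ≤ γ) (hD0 : 0 ≤ D)
    (hD : D ≤ κ * s * Real.exp γ) :
    D ^ 2 * (1 + D) ^ (2 * m + 2) ≤ 2 * κ ^ 2 * Real.exp (5 / 4 * s + (2 * m + 4) * γ) := by
  have h1 : 1 + D ≤ Real.exp (κ * s + γ) := by
    have hγ1 : 1 ≤ Real.exp γ := Real.one_le_exp hγ
    have := Real.add_one_le_exp (κ * s)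
    rw [Real.exp_add]
    nlinarith [mul_nonneg hκ hs]
  have h2 : s ^ 2 ≤ 2 * Real.exp s := by
    linarith [Real.quadratic_le_exp_of_nonneg hs]
  calc D ^ 2 * (1 + D) ^ (2 * m + 2)
      ≤ (κ * s * Real.exp γ) ^ 2 * Real.exp (κ * s + γ) ^ (2 * m + 2) := by gcongr
    _ = κ ^ 2 * s ^ 2 * (Real.exp γ ^ 2 * Real.exp (κ * s + γ) ^ (2 * m + 2)) := by ring
    _ ≤ κ ^ 2 * (2 * Real.exp s) * (Real.exp γ ^ 2 * Real.exp (κ * s + γ) ^ (2 * m + 2)) := by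
        gcongr
    _ = 2 * κ ^ 2 * Real.exp (s + (2 * γ + (2 * m + 2) * (κ * s + γ))) := by
        rw [← Real.exp_nat_mul, ← Real.exp_nat_mul, Real.exp_add s, Real.exp_add (2 * γ)]
        push_cast; ring
    _ ≤ _ := by
        refine mul_le_mul_of_nonneg_left (Real.exp_le_exp.2 ?_) (by positivity)
        nlinarith [mul_le_mul_of_nonneg_right hκm hs]

/-- The second-order remainder is dominated by exponentials of linear functionals of `ξ`, whose
Gaussian integrals are explicit. -/
theorem exists_dominating_function {d : ℕ} {ρ R κ : ℝ} (hρ : 0 < ρ) (m : ℕ) (hκ : 0 ≤ κ)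
    (hκm : κ * (2 * m + 2) ≤ 1 / 4) (hRm : (2 * m + 4) * (R / ρ) ≤ 1 / 6) {v v' : E d}
    (hv : ‖v‖ ≤ R) (hv' : ‖v'‖ ≤ R) (hne : v - v' ≠ 0) :
    ∃ B : E d → ℝ, Measurable B ∧ (∀ ξ, 0 ≤ B ξ) ∧
      ∫⁻ ξ, ENNReal.ofReal (B ξ) ∂gauss d ρ ≤ ENNReal.ofReal (100 * κ ^ 2) ∧
      ∀ ξ, (κ * ρ * |weight ρ v ξ - weight ρ v' ξ| / ‖v - v'‖) ^ 2 *
        (1 + κ * ρ * |weight ρ v ξ - weight ρ v' ξ| / ‖v - v'‖) ^ (2 * m + 2) ≤ B ξ := by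
  set φ := ‖v - v'‖ with hφdef
  have hφ : 0 < φ := norm_pos_iff.2 hne
  have hR0 : 0 ≤ R := (norm_nonneg v).trans hv
  -- The factors `3/2` and `12` are those of `exp_combination_le`. They give `ρ ‖u1‖ = 3/2`, and
  -- `hRm` gives `ρ ‖s2 • v‖ ≤ 2`.
  set u1 : E d := (3 / 2 / (ρ * φ)) • (v - v') with hu1
  set s2 : ℝ := 12 * (2 * m + 4) / ρ ^ 2 with hs2
  have hs2pos : 0 ≤ s2 := by positivity
  set c0 : ℝ := 2 * κ ^ 2 * Real.exp (5 / 4 * (R / ρ)) with hc0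
  have hc0pos : 0 ≤ c0 := by positivity
  refine ⟨fun ξ => c0 * (Real.exp |inner ℝ u1 ξ| + Real.exp |inner ℝ (s2 • v) ξ| +
    Real.exp |inner ℝ (s2 • v') ξ|), by fun_prop, fun ξ => by positivity, ?_, fun ξ => ?_⟩
  · have hb1 := lintegral_exp_abs_inner_le hρ u1 (s := 3 / 2) (by
      rw [hu1, norm_smul, Real.norm_eq_abs, abs_of_pos (by positivity), ← hφdef]
      apply le_of_eq; field_simp)
    have hb2 : ∀ w : E d, ‖w‖ ≤ R → ρ * ‖s2 • w‖ ≤ 2 := fun w hw => by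
      rw [norm_smul, Real.norm_eq_abs, abs_of_nonneg hs2pos]
      calc ρ * (s2 * ‖w‖) ≤ ρ * (s2 * R) := by gcongr
        _ = 12 * ((2 * m + 4) * (R / ρ)) := by rw [hs2]; field_simp
        _ ≤ 2 := by linarith
    have hb3 := lintegral_exp_abs_inner_le hρ _ (hb2 v hv)
    have hb4 := lintegral_exp_abs_inner_le hρ _ (hb2 v' hv')
    simp_rw [ENNReal.ofReal_mul hc0pos]
    rw [lintegral_const_mul _ (by fun_prop)]
    have hsplit : ∀ ξ : E d, ENNReal.ofReal (Real.exp |inner ℝ u1 ξ| +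
        Real.exp |inner ℝ (s2 • v) ξ| + Real.exp |inner ℝ (s2 • v') ξ|) =
        ENNReal.ofReal (Real.exp |inner ℝ u1 ξ|) + ENNReal.ofReal (Real.exp |inner ℝ (s2 • v) ξ|) +
          ENNReal.ofReal (Real.exp |inner ℝ (s2 • v') ξ|) := fun ξ => by
      rw [ENNReal.ofReal_add (by positivity) (by positivity),
        ENNReal.ofReal_add (by positivity) (by positivity)]
    simp_rw [hsplit]
    rw [lintegral_add_left (by fun_prop), lintegral_add_left (by fun_prop)]
    refine (mul_le_mul_right (add_le_add (add_le_add hb1 hb3) hb4) _).trans ?_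
    rw [← ENNReal.ofReal_add (by positivity) (by positivity),
      ← ENNReal.ofReal_add (by positivity) (by positivity), ← ENNReal.ofReal_mul hc0pos]
    refine ENNReal.ofReal_le_ofReal ?_
    have hRρ : R / ρ ≤ 1 / 24 := by
      have : 0 ≤ R / ρ := by positivity
      nlinarith [(Nat.cast_nonneg m : (0 : ℝ) ≤ m)]
    have he : Real.exp 1 ≤ 2.72 := by linarith [Real.exp_one_lt_d9]
    have e1 : Real.exp (5 / 4 * (R / ρ)) ≤ 1.1 := by
      have h1 : Real.exp (5 / 4 * (R / ρ)) ≤ Real.exp (1 / 19) :=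
        Real.exp_le_exp.2 (by linarith)
      have h2 : Real.exp (1 / 19) ^ 19 ≤ 1.1 ^ 19 := by
        rw [← Real.exp_nat_mul]; norm_num; norm_num at he; linarith
      exact h1.trans (le_of_pow_le_pow_left₀ (by norm_num) (by norm_num) h2)
    have e2 : Real.exp ((2 : ℝ) ^ 2 / 2) ≤ 7.5 := by
      have : (2 : ℝ) ^ 2 / 2 = (2 : ℕ) * 1 := by norm_num
      rw [this, Real.exp_nat_mul]
      nlinarith [Real.exp_pos 1]
    have e3 : Real.exp ((3 / 2 : ℝ) ^ 2 / 2) ≤ 7.5 :=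
      (Real.exp_le_exp.2 (by norm_num)).trans e2
    -- Numerically `2.2 · 45 = 99`, whence the constant `100`.
    calc c0 * (2 * Real.exp ((3 / 2) ^ 2 / 2) + 2 * Real.exp (2 ^ 2 / 2) + 2 * Real.exp (2 ^ 2 / 2))
        ≤ (2 * κ ^ 2 * 1.1) * (2 * 7.5 + 2 * 7.5 + 2 * 7.5) := by rw [hc0]; gcongr
      _ ≤ _ := by nlinarith [sq_nonneg κ]
  · have hγ0 : 0 ≤ (|inner ℝ v ξ| + |inner ℝ v' ξ|) / ρ ^ 2 := by positivity
    have hs0 : 0 ≤ |inner ℝ (v - v') ξ| / (ρ * φ) + R / ρ := by positivity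
    refine (sq_mul_one_add_pow_le_exp (s := |inner ℝ (v - v') ξ| / (ρ * φ) + R / ρ)
      (γ := (|inner ℝ v ξ| + |inner ℝ v' ξ|) / ρ ^ 2) m hκ hκm hs0 hγ0
      (by positivity) ?_).trans ?_
    · calc κ * ρ * |weight ρ v ξ - weight ρ v' ξ| / φ
          ≤ κ * ρ * ((|inner ℝ (v - v') ξ| + R * φ) / ρ ^ 2 *
            Real.exp ((|inner ℝ v ξ| + |inner ℝ v' ξ|) / ρ ^ 2)) / φ := by
            gcongr
            exact abs_weight_sub_le hρ hv hv' ξ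
        _ = _ := by field_simp
    · have hexp : 5 / 4 * (|inner ℝ (v - v') ξ| / (ρ * φ) + R / ρ) +
          (2 * m + 4) * ((|inner ℝ v ξ| + |inner ℝ v' ξ|) / ρ ^ 2) =
          5 / 4 * (R / ρ) + (5 / 4 * (|inner ℝ (v - v') ξ| / (ρ * φ)) +
            (2 * m + 4) * |inner ℝ v ξ| / ρ ^ 2 + (2 * m + 4) * |inner ℝ v' ξ| / ρ ^ 2) := by ring
      rw [hexp, Real.exp_add, ← mul_assoc]
      dsimp only
      rw [hc0]
      refine mul_le_mul_of_nonneg_left ((exp_combination_le _ _ _).trans (le_of_eq ?_))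
        (by positivity)
      rw [hu1, real_inner_smul_left, real_inner_smul_left, real_inner_smul_left, abs_mul, abs_mul,
        abs_mul, abs_of_nonneg hs2pos, abs_of_pos (by positivity : 0 < 3 / 2 / (ρ * φ)), hs2]
      congr 1
      · congr 1
        · congr 1; ring
        · congr 1; ring
      · congr 1; ring

/-- The change of variables removes the weights from the linear term: its mean becomes a nonnegative
multiple of the mean of `⟨v - v', h(v + ξ) - h(v' + ξ)⟩`, and it enters with a minus sign, so
monotonicity allows it to be dropped. The remainder is `5 m² · 100 κ²` with `κ = lam L / ρ`. -/
theorem lintegral_common_step_le {d : ℕ} {ρ R lam L : ℝ} (hρ : 0 < ρ) (hlam : 0 ≤ lam)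
    (hL : 0 ≤ L) (m : ℕ) (hκm : lam * L / ρ * (2 * m + 2) ≤ 1 / 4)
    (hRm : (2 * m + 4) * (R / ρ) ≤ 1 / 6) {v v' : E d} (hv : ‖v‖ ≤ R) (hv' : ‖v'‖ ≤ R)
    {h : E d → E d} (hh : Measurable h) (hhL : ∀ ξ, ‖h ξ‖ ≤ L)
    (hmono : ∀ ξ, 0 ≤ inner ℝ (v - v') (h (v + ξ) - h (v' + ξ))) :
    ∫⁻ ξ, ENNReal.ofReal
        (‖(v - v') - lam • ((weight ρ v ξ - weight ρ v' ξ) • h ξ)‖ ^ (2 * m)) ∂gauss d ρ ≤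
      ENNReal.ofReal ((1 + 500 * m ^ 2 * (lam * L / ρ) ^ 2) * ‖v - v'‖ ^ (2 * m)) := by
  by_cases hne : v - v' = 0
  · obtain rfl := sub_eq_zero.1 hne
    have h1 : ∀ ξ, (v - v) - lam • ((weight ρ v ξ - weight ρ v ξ) • h ξ) = v - v := by simp
    simp_rw [h1]
    rw [lintegral_const, measure_univ, mul_one]
    refine ENNReal.ofReal_le_ofReal (le_mul_of_one_le_left (by positivity) ?_)
    have : (0 : ℝ) ≤ 500 * m ^ 2 * (lam * L / ρ) ^ 2 := by positivity
    linarith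
  set κ := lam * L / ρ with hκdef
  have hκ : 0 ≤ κ := by positivity
  obtain ⟨B, hBm, hB0, hBint, hB⟩ := exists_dominating_function hρ m hκ hκm hRm hv hv' hne
  set φ := ‖v - v'‖ with hφdef
  have hφ : 0 < φ := norm_pos_iff.2 hne
  set A : E d → E d := fun ξ => lam • ((weight ρ v ξ - weight ρ v' ξ) • h ξ) with hA
  have hinner : ∀ x : E d, |inner ℝ (v - v') (h x)| ≤ φ * L := fun x =>
    (abs_real_inner_le_norm _ _).trans (by gcongr; exact hhL x)
  have hgm : Measurable fun x => inner ℝ (v - v') (h x) := by fun_prop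
  have hint : ∀ w : E d, Integrable (fun ξ => weight ρ w ξ * inner ℝ (v - v') (h ξ))
      (gauss d ρ) := fun w =>
    (integrable_weight hρ w).mul_bdd (c := φ * L) hgm.aestronglyMeasurable
      (ae_of_all _ fun x => hinner x)
  have hint' : ∀ w : E d, Integrable (fun ξ => inner ℝ (v - v') (h (w + ξ))) (gauss d ρ) :=
    fun w => Integrable.of_bound (hgm.comp (measurable_const_add w)).aestronglyMeasurable (φ * L)
      (ae_of_all _ fun x => hinner _)
  have hNeq : ∀ ξ, inner ℝ (v - v') (A ξ) / φ ^ 2 =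
      lam / φ ^ 2 * (weight ρ v ξ * inner ℝ (v - v') (h ξ) -
        weight ρ v' ξ * inner ℝ (v - v') (h ξ)) := fun ξ => by
    rw [hA]
    simp only [real_inner_smul_right]
    ring
  have hNint : Integrable (fun ξ => inner ℝ (v - v') (A ξ) / φ ^ 2) (gauss d ρ) := by
    simp_rw [hNeq]
    exact ((hint v).sub (hint v')).const_mul _
  have hN0 : 0 ≤ ∫ ξ, inner ℝ (v - v') (A ξ) / φ ^ 2 ∂gauss d ρ := by
    simp_rw [hNeq]
    rw [integral_const_mul, integral_sub (hint v) (hint v'), ← integral_gauss_shift hρ v hgm,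
      ← integral_gauss_shift hρ v' hgm, ← integral_sub (hint' v) (hint' v')]
    refine mul_nonneg (by positivity) (integral_nonneg fun ξ => ?_)
    have := hmono ξ
    rwa [inner_sub_right] at this
  have hBI : Integrable B (gauss d ρ) := by
    refine ⟨hBm.aestronglyMeasurable, ?_⟩
    rw [hasFiniteIntegral_iff_ofReal (ae_of_all _ hB0)]
    exact hBint.trans_lt ENNReal.ofReal_lt_top
  have hBle : ∫ ξ, B ξ ∂gauss d ρ ≤ 100 * κ ^ 2 := by
    rw [integral_eq_lintegral_of_nonneg_ae (ae_of_all _ hB0) hBm.aestronglyMeasurable]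
    exact ENNReal.toReal_le_of_le_ofReal (by positivity) hBint
  have hpt : ∀ ξ, ‖(v - v') - A ξ‖ ^ (2 * m) ≤ φ ^ (2 * m) *
      (1 - 2 * m * (inner ℝ (v - v') (A ξ) / φ ^ 2) + 5 * m ^ 2 * B ξ) := fun ξ => by
    have hAle : ‖A ξ‖ ≤ (κ * ρ * |weight ρ v ξ - weight ρ v' ξ| / φ) * φ := by
      rw [div_mul_cancel₀ _ hφ.ne', hA]
      dsimp only
      rw [norm_smul, norm_smul, Real.norm_eq_abs, Real.norm_eq_abs, abs_of_nonneg hlam, hκdef,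
        div_mul_cancel₀ _ hρ.ne']
      calc lam * (|weight ρ v ξ - weight ρ v' ξ| * ‖h ξ‖)
          ≤ lam * (|weight ρ v ξ - weight ρ v' ξ| * L) := by gcongr; exact hhL ξ
        _ = _ := by ring
    refine (norm_sub_pow_le hne hAle m).trans ?_
    gcongr
    exact hB ξ
  have hI2 : Integrable (fun ξ => φ ^ (2 * m) *
      (1 - 2 * m * (inner ℝ (v - v') (A ξ) / φ ^ 2) + 5 * m ^ 2 * B ξ)) (gauss d ρ) :=
    (((integrable_const 1).sub (hNint.const_mul _)).add (hBI.const_mul _)).const_mul _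
  calc ∫⁻ ξ, ENNReal.ofReal (‖(v - v') - A ξ‖ ^ (2 * m)) ∂gauss d ρ
      ≤ ∫⁻ ξ, ENNReal.ofReal (φ ^ (2 * m) *
        (1 - 2 * m * (inner ℝ (v - v') (A ξ) / φ ^ 2) + 5 * m ^ 2 * B ξ)) ∂gauss d ρ :=
        lintegral_mono fun ξ => ENNReal.ofReal_le_ofReal (hpt ξ)
    _ = ENNReal.ofReal (∫ ξ, φ ^ (2 * m) *
        (1 - 2 * m * (inner ℝ (v - v') (A ξ) / φ ^ 2) + 5 * m ^ 2 * B ξ) ∂gauss d ρ) :=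
        (ofReal_integral_eq_lintegral_ofReal hI2
          (ae_of_all _ fun ξ => (by positivity : (0 : ℝ) ≤ _).trans (hpt ξ))).symm
    _ ≤ _ := by
        refine ENNReal.ofReal_le_ofReal ?_
        rw [integral_const_mul, integral_add
          (f := fun ξ => 1 - 2 * m * (inner ℝ (v - v') (A ξ) / φ ^ 2))
          ((integrable_const 1).sub (hNint.const_mul _)) (hBI.const_mul _), integral_sub (integrable_const 1) (hNint.const_mul _),
          integral_const_mul, integral_const_mul, integral_const, probReal_univ, mul_comm]
        refine mul_le_mul_of_nonneg_right ?_ (by positivity)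
        have h1 : (0 : ℝ) ≤ 2 * m * ∫ ξ, inner ℝ (v - v') (A ξ) / φ ^ 2 ∂gauss d ρ := by
          positivity
        have h2 : 5 * (m : ℝ) ^ 2 * ∫ ξ, B ξ ∂gauss d ρ ≤ 5 * m ^ 2 * (100 * κ ^ 2) := by gcongr
        simp only [smul_eq_mul]
        linarith

/-! ### Projections and subgradients -/

/-- The two obtuse-angle inequalities, at `x` and at `y`, add up to `‖p - q‖² ≤ ⟨x - y, p - q⟩` for
the projections `p`, `q`. -/
theorem norm_ballProj_sub_le {d : ℕ} (c : E d) {r : ℝ} (hr : 0 ≤ r) (x y : E d) :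
    ‖ballProj c r x - ballProj c r y‖ ≤ ‖x - y‖ := by
  set p := ballProj c r x with hp
  set q := ballProj c r y with hq
  have h1 := ballProj_unique c hr x q (ballProj_mem c hr y)
  have h2 := ballProj_unique c hr y p (ballProj_mem c hr x)
  rw [← hp] at h1
  rw [← hq] at h2
  have e1 : x - q = (x - p) - (q - p) := by abel
  have e2 : y - p = (y - q) - (p - q) := by abel
  rw [e1, norm_sub_sq_real (x - p) (q - p)] at h1
  rw [e2, norm_sub_sq_real (y - q) (p - q)] at h2
  have e3 : inner ℝ (x - p) (q - p) = inner ℝ (p - x) (p - q) := by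
    rw [← inner_neg_neg]; simp
  have e4 : inner ℝ (x - y) (p - q) = inner ℝ (p - q) (p - q) -
      inner ℝ (p - x) (p - q) - inner ℝ (y - q) (p - q) := by
    rw [← inner_sub_left, ← inner_sub_left]; congr 1; abel
  rw [real_inner_self_eq_norm_sq] at e4
  have h3 : ‖p - q‖ ^ 2 ≤ ‖x - y‖ * ‖p - q‖ := by
    have := real_inner_le_norm (x - y) (p - q)
    rw [norm_sub_rev q p] at h1
    linarith
  rcases (norm_nonneg (p - q)).eq_or_lt' with h0 | h0
  · rw [h0]; exact norm_nonneg _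
  · nlinarith

theorem measurable_ballProj {d : ℕ} (c : E d) {r : ℝ} (hr : 0 ≤ r) :
    Measurable (ballProj c r) :=
  (LipschitzWith.of_dist_le_mul (K := 1) fun x y => by
    simpa [dist_eq_norm] using norm_ballProj_sub_le c hr x y).continuous.measurable

/-- A family of measurable, monotone and bounded vector fields. -/
structure IsOracle {d : ℕ} {S : Type*} (L : ℝ) (g : S → E d → E d) : Prop where
  measurable : ∀ s, Measurable (g s)
  norm_le : ∀ s x, ‖g s x‖ ≤ L
  monotone : ∀ s x y, 0 ≤ inner ℝ (x - y) (g s x - g s y)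

theorem IsSubgradient.norm_le {d : ℕ} {f : E d → ℝ} {L : ℝ} (hL : 0 ≤ L)
    (hf : ∀ x y, |f x - f y| ≤ L * ‖x - y‖) {x v : E d} (hv : IsSubgradient f x v) : ‖v‖ ≤ L := by
  have h1 := hv (x + v)
  have h2 := (le_abs_self _).trans (hf (x + v) x)
  rw [add_sub_cancel_left] at h1 h2
  rw [real_inner_self_eq_norm_sq] at h1
  rcases (norm_nonneg v).eq_or_lt' with h0 | h0
  · rwa [h0]
  · nlinarith

theorem IsSubgradient.monotone {d : ℕ} {f : E d → ℝ} {x y v w : E d} (hv : IsSubgradient f x v)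
    (hw : IsSubgradient f y w) : 0 ≤ inner ℝ (x - y) (v - w) := by
  have h1 := hv y
  have h2 := hw x
  have e : inner ℝ (x - y) (v - w) = -inner ℝ v (y - x) - inner ℝ w (x - y) := by
    rw [inner_sub_right, real_inner_comm, ← neg_sub x y, inner_neg_right, real_inner_comm w]
    ring
  linarith

/-! ### Resampling one coordinate of a product measure -/

theorem map_update_infinitePi {X : Type*} [MeasurableSpace X] (μ : Measure X)
    [IsProbabilityMeasure μ] (n : ℕ) :
    ((Measure.infinitePi fun _ : ℕ => μ).prod μ).map
      (fun p : (ℕ → X) × X => Function.update p.1 n p.2) = Measure.infinitePi fun _ => μ := by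
  have hmeas : Measurable fun p : (ℕ → X) × X => Function.update p.1 n p.2 := measurable_update'
  refine Measure.eq_infinitePi _ fun s t ht => ?_
  rw [Measure.map_apply hmeas (MeasurableSet.pi s.countable_toSet fun i _ => ht i)]
  by_cases hn : n ∈ s
  · have hpre : (fun p : (ℕ → X) × X => Function.update p.1 n p.2) ⁻¹' ((s : Set ℕ).pi t) =
        (((s.erase n : Finset ℕ) : Set ℕ).pi t) ×ˢ t n := by
      ext p
      simp only [Set.mem_preimage, Set.mem_pi, Set.mem_prod, Finset.mem_coe, Finset.mem_erase]
      constructor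
      · intro h
        refine ⟨fun i hi => ?_, ?_⟩
        · simpa [Function.update_of_ne hi.1] using h i hi.2
        · simpa using h n hn
      · rintro ⟨h1, h2⟩ i hi
        by_cases hin : i = n
        · subst hin; simpa using h2
        · simpa [Function.update_of_ne hin] using h1 i ⟨hin, hi⟩
    rw [hpre, Measure.prod_prod, Measure.infinitePi_pi _ fun i _ => ht i,
      Finset.prod_erase_mul _ _ hn]
  · have hpre : (fun p : (ℕ → X) × X => Function.update p.1 n p.2) ⁻¹' ((s : Set ℕ).pi t) =
        ((s : Set ℕ).pi t) ×ˢ Set.univ := by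
      ext p
      simp only [Set.mem_preimage, Set.mem_pi, Set.mem_prod, Set.mem_univ, and_true]
      refine forall₂_congr fun i hi => ?_
      rw [Function.update_of_ne (fun h => hn (by rw [← h]; exact hi))]
    rw [hpre, Measure.prod_prod, Measure.infinitePi_pi _ fun i _ => ht i, measure_univ, mul_one]

/-- Independence of `ξ n` from a function that ignores coordinate `n`, in Fubini form. It is used
with `n = j + 1` and `f` the iterates after `j` steps. -/
theorem lintegral_infinitePi_resample {X β : Type*} [MeasurableSpace X] [MeasurableSpace β]
    (μ : Measure X) [IsProbabilityMeasure μ] (n : ℕ) {f : (ℕ → X) → β} (hf : Measurable f)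
    (hfn : ∀ ξ a, f (Function.update ξ n a) = f ξ) {F : β × X → ℝ≥0∞} (hF : Measurable F) :
    ∫⁻ ξ, F (f ξ, ξ n) ∂Measure.infinitePi (fun _ : ℕ => μ) =
      ∫⁻ ξ, ∫⁻ a, F (f ξ, a) ∂μ ∂Measure.infinitePi (fun _ : ℕ => μ) := by
  have hG : Measurable fun ξ : ℕ → X => F (f ξ, ξ n) := by fun_prop
  conv_lhs => rw [← map_update_infinitePi μ n]
  have hG' : Measurable fun p : (ℕ → X) × X =>
      F (f (Function.update p.1 n p.2), Function.update p.1 n p.2 n) :=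
    hG.comp measurable_update'
  rw [lintegral_map hG measurable_update', lintegral_prod _ hG'.aemeasurable]
  simp [hfn]

/-- Minkowski's inequality, phrased for `n`-th powers to fit the moment recursion. -/
theorem lintegral_add_pow_le {Ω : Type*} [MeasurableSpace Ω] {μ : Measure Ω} {f g : Ω → ℝ}
    (hf : Measurable f) (hg : Measurable g) (hf0 : ∀ x, 0 ≤ f x) (hg0 : ∀ x, 0 ≤ g x) {a b : ℝ}
    (ha : 0 ≤ a) (hb : 0 ≤ b) {n : ℕ} (hn : 1 ≤ n)
    (hfa : ∫⁻ x, ENNReal.ofReal (f x ^ n) ∂μ ≤ ENNReal.ofReal (a ^ n))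
    (hgb : ∫⁻ x, ENNReal.ofReal (g x ^ n) ∂μ ≤ ENNReal.ofReal (b ^ n)) :
    ∫⁻ x, ENNReal.ofReal ((f x + g x) ^ n) ∂μ ≤ ENNReal.ofReal ((a + b) ^ n) := by
  have hn0 : (0 : ℝ) < n := by exact_mod_cast hn
  have conv : ∀ {h : Ω → ℝ} {c : ℝ}, (∀ x, 0 ≤ h x) → 0 ≤ c →
      (∫⁻ x, ENNReal.ofReal (h x ^ n) ∂μ ≤ ENNReal.ofReal (c ^ n) ↔
        (∫⁻ x, ENNReal.ofReal (h x) ^ (n : ℝ) ∂μ) ^ (1 / (n : ℝ)) ≤ ENNReal.ofReal c) := by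
    intro h c hh hc
    simp_rw [ENNReal.rpow_natCast]
    rw [one_div, ENNReal.rpow_inv_le_iff hn0, ENNReal.rpow_natCast]
    simp_rw [ENNReal.ofReal_pow (hh _)]
    rw [ENNReal.ofReal_pow hc]
  rw [conv (fun x => add_nonneg (hf0 x) (hg0 x)) (add_nonneg ha hb)]
  rw [conv hf0 ha] at hfa
  rw [conv hg0 hb] at hgb
  simp_rw [ENNReal.ofReal_add (hf0 _) (hg0 _)]
  rw [ENNReal.ofReal_add ha hb]
  exact (ENNReal.lintegral_Lp_add_le hf.ennreal_ofReal.aemeasurable hg.ennreal_ofReal.aemeasurable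
    (by exact_mod_cast hn)).trans (add_le_add hfa hgb)

/-! ### Stability of one inner loop -/

section InnerLoop

variable {d n : ℕ} {S : Type*} {P : Params d} {g : S → E d → E d} {D D' : Fin n → S}
  {z : ℕ → ℕ → Fin n} {i : ℕ}

theorem measurable_projStep (hr : 0 ≤ P.r) (hg : IsOracle P.L g) {Ω : Type*} [MeasurableSpace Ω]
    {y a : Ω → E d} (hy : Measurable y) (ha : Measurable a) (lam : ℝ) (s : S) :
    Measurable fun ω =>
      ballProj P.xbar P.r (y ω - lam • estimator P.xbar P.ρ (g s) (a ω) (y ω)) := by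
  have hest : Measurable fun ω => estimator P.xbar P.ρ (g s) (a ω) (y ω) :=
    ((measurable_weight P.ρ).comp ((hy.sub_const P.xbar).prodMk ha)).smul
      ((hg.measurable s).comp (ha.const_add P.xbar))
  exact (measurable_ballProj _ hr).comp (hy.sub (hest.const_smul lam))

theorem measurable_innerIter (hr : 0 ≤ P.r) (hg : IsOracle P.L g) (j : ℕ) :
    Measurable fun p : E d × (ℕ → E d) => innerIter P g D z i p.1 p.2 j := by
  induction j with
  | zero => exact measurable_fst
  | succ j ih => exact measurable_projStep hr hg ih (by fun_prop) _ _

theorem measurable_innerAvg (hr : 0 ≤ P.r) (hg : IsOracle P.L g) :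
    Measurable fun p : E d × (ℕ → E d) => innerAvg P g D z i p.1 p.2 := by
  have h : Measurable fun p : E d × (ℕ → E d) =>
      ∑ j ∈ Finset.Icc 1 (P.Ti i), innerIter P g D z i p.1 p.2 j :=
    Finset.measurable_fun_sum _ fun j _ => measurable_innerIter hr hg j
  exact h.const_smul (1 / (P.Ti i : ℝ))

theorem innerIter_update (y0 : E d) (ξ : ℕ → E d) {j l : ℕ} (hjl : j < l) (a : E d) :
    innerIter P g D z i y0 (Function.update ξ l a) j = innerIter P g D z i y0 ξ j := by
  induction j with
  | zero => rfl
  | succ j ih => simp only [innerIter, ih (by omega), Function.update_of_ne hjl.ne]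

theorem norm_innerIter_succ_sub_le (hr : 0 ≤ P.r) (y0 : E d) (ξ : ℕ → E d) (j : ℕ) :
    ‖innerIter P g D z i y0 ξ (j + 1) - P.xbar‖ ≤ P.r :=
  mem_closedBall_iff_norm.1 (ballProj_mem _ hr _)

theorem norm_innerIter_sub_le (hr : 0 ≤ P.r) {R : ℝ} (hrR : P.r ≤ R) {y0 : E d}
    (hy0 : ‖y0 - P.xbar‖ ≤ R) (ξ : ℕ → E d) (j : ℕ) :
    ‖innerIter P g D z i y0 ξ j - P.xbar‖ ≤ R := by
  cases j with
  | zero => exact hy0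
  | succ j => exact (norm_innerIter_succ_sub_le hr y0 ξ j).trans hrR

theorem norm_innerAvg_sub_le (hr : 0 ≤ P.r) (hT : 1 ≤ P.Ti i) (y0 : E d) (ξ : ℕ → E d) :
    ‖innerAvg P g D z i y0 ξ - P.xbar‖ ≤ P.r := by
  have hpos : (0 : ℝ) < P.Ti i := by exact_mod_cast hT
  have h1 : innerAvg P g D z i y0 ξ - P.xbar =
      (1 / (P.Ti i : ℝ)) • ∑ j ∈ Finset.Icc 1 (P.Ti i), (innerIter P g D z i y0 ξ j - P.xbar) := by
    rw [Finset.sum_sub_distrib, smul_sub, Finset.sum_const, Nat.card_Icc, ← Nat.cast_smul_eq_nsmul ℝ,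
      smul_smul, Nat.add_sub_cancel, one_div_mul_cancel hpos.ne', one_smul]
    rfl
  rw [h1, norm_smul, Real.norm_eq_abs, abs_of_pos (by positivity), one_div,
    inv_mul_le_iff₀ hpos]
  refine (norm_sum_le_of_le (n := fun _ => P.r) _ fun j hj => ?_).trans (by simp)
  obtain ⟨l, rfl⟩ := Nat.exists_eq_add_of_le' (Finset.mem_Icc.1 hj).1
  exact norm_innerIter_succ_sub_le hr y0 ξ l

theorem lintegral_common_projStep_le (hr : 0 ≤ P.r) (hρ : 0 < P.ρ) (hL : 0 ≤ P.L)
    (hg : IsOracle P.L g) {lam R : ℝ} (hlam : 0 ≤ lam) (m : ℕ)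
    (hκm : lam * P.L / P.ρ * (2 * m + 2) ≤ 1 / 4) (hRm : (2 * m + 4) * (R / P.ρ) ≤ 1 / 6) (s : S)
    {y y' : E d} (hy : ‖y - P.xbar‖ ≤ R) (hy' : ‖y' - P.xbar‖ ≤ R) :
    ∫⁻ a, ENNReal.ofReal
        (‖ballProj P.xbar P.r (y - lam • estimator P.xbar P.ρ (g s) a y) -
          ballProj P.xbar P.r (y' - lam • estimator P.xbar P.ρ (g s) a y')‖ ^ (2 * m))
        ∂gauss d P.ρ ≤
      ENNReal.ofReal ((1 + 500 * m ^ 2 * (lam * P.L / P.ρ) ^ 2) * ‖y - y'‖ ^ (2 * m)) := by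
  have hsub : (y - P.xbar) - (y' - P.xbar) = y - y' := sub_sub_sub_cancel_right _ _ _
  have key := lintegral_common_step_le hρ hlam hL m hκm hRm hy hy'
    (h := fun ξ => g s (P.xbar + ξ)) ((hg.measurable s).comp (measurable_const_add _))
    (fun ξ => hg.norm_le s _) (fun ξ => by
      have := hg.monotone s (P.xbar + (y - P.xbar + ξ)) (P.xbar + (y' - P.xbar + ξ))
      have e : P.xbar + (y - P.xbar + ξ) - (P.xbar + (y' - P.xbar + ξ)) =
          (y - P.xbar) - (y' - P.xbar) := by abel
      rwa [e] at this)
  rw [hsub] at key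
  refine (lintegral_mono fun a => ENNReal.ofReal_le_ofReal ?_).trans key
  gcongr
  refine (norm_ballProj_sub_le _ hr _ _).trans (le_of_eq ?_)
  congr 1
  change y - lam • (weight P.ρ (y - P.xbar) a • g s (P.xbar + a)) -
    (y' - lam • (weight P.ρ (y' - P.xbar) a • g s (P.xbar + a))) = _
  rw [sub_smul, smul_sub]
  abel

/-- With `p = 2m` the moment of the weight is `exp (p (p - 1) ‖v‖² / (2ρ²))`. Since `hRm` forces `p
R / ρ ≤ 1`, it is at most `exp (1/2) ≤ 2`. -/
theorem lintegral_weight_pow_le {ρ R c : ℝ} (hρ : 0 < ρ) (hc : 0 ≤ c) {v : E d} (hv : ‖v‖ ≤ R)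
    {m : ℕ} (hm : 1 ≤ m) (hRm : (2 * m + 4) * (R / ρ) ≤ 1 / 6) :
    ∫⁻ a, ENNReal.ofReal ((c * weight ρ v a) ^ (2 * m)) ∂gauss d ρ ≤
      ENNReal.ofReal ((c * 2) ^ (2 * m)) := by
  have hR0 : 0 ≤ R := (norm_nonneg v).trans hv
  have h1 : ∀ a, ENNReal.ofReal ((c * weight ρ v a) ^ (2 * m)) =
      ENNReal.ofReal (c ^ (2 * m)) * ENNReal.ofReal (weight ρ v a) ^ ((2 * m : ℕ) : ℝ) := fun a => by
    rw [ENNReal.rpow_natCast, ← ENNReal.ofReal_pow (weight_pos hρ v a).le,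
      ← ENNReal.ofReal_mul (by positivity), mul_pow]
  simp_rw [h1]
  rw [lintegral_const_mul _ ((measurable_weight_right ρ v).ennreal_ofReal.pow_const _),
    lintegral_weight_pow hρ v (by positivity), ← ENNReal.ofReal_mul (by positivity), mul_pow]
  refine ENNReal.ofReal_le_ofReal ?_
  gcongr
  set p : ℝ := ((2 * m : ℕ) : ℝ) with hp
  have hp0 : 0 ≤ p := by positivity
  have h2 : p * (p - 1) * ‖v‖ ^ 2 / (2 * ρ ^ 2) ≤ 1 / 2 := by
    have h3 : p * (R / ρ) ≤ 1 := by
      have : 0 ≤ R / ρ := by positivity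
      rw [hp]; push_cast
      nlinarith
    calc p * (p - 1) * ‖v‖ ^ 2 / (2 * ρ ^ 2) ≤ p * p * R ^ 2 / (2 * ρ ^ 2) := by
          gcongr; linarith
      _ = (p * (R / ρ)) ^ 2 / 2 := by ring
      _ ≤ 1 ^ 2 / 2 := by gcongr
      _ = _ := by norm_num
  have h4 : Real.exp (1 / 2) ≤ 2 := by
    have : Real.exp (1 / 2) ^ 2 ≤ 2 ^ 2 := by
      rw [← Real.exp_nat_mul]; norm_num; linarith [Real.exp_one_lt_d9]
    exact le_of_pow_le_pow_left₀ two_ne_zero (by norm_num) this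
  exact ((Real.exp_le_exp.2 h2).trans h4).trans (le_self_pow₀ (by norm_num) (by omega))

theorem norm_projStep_sub_le (hr : 0 ≤ P.r) (hρ : 0 < P.ρ) (hg : IsOracle P.L g) {lam : ℝ}
    (hlam : 0 ≤ lam) (s s' : S) (y y' a : E d) :
    ‖ballProj P.xbar P.r (y - lam • estimator P.xbar P.ρ (g s) a y) -
        ballProj P.xbar P.r (y' - lam • estimator P.xbar P.ρ (g s') a y')‖ ≤
      ‖y - y'‖ + (lam * P.L * weight P.ρ (y - P.xbar) a +
        lam * P.L * weight P.ρ (y' - P.xbar) a) := by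
  have hest : ∀ (s : S) (y : E d), ‖lam • estimator P.xbar P.ρ (g s) a y‖ ≤
      lam * P.L * weight P.ρ (y - P.xbar) a := fun s y => by
    have hw := weight_pos hρ (y - P.xbar) a
    change ‖lam • (weight P.ρ (y - P.xbar) a • g s (P.xbar + a))‖ ≤ _
    rw [norm_smul, norm_smul, Real.norm_eq_abs, Real.norm_eq_abs, abs_of_nonneg hlam,
      abs_of_pos hw]
    calc lam * (weight P.ρ (y - P.xbar) a * ‖g s (P.xbar + a)‖)
        ≤ lam * (weight P.ρ (y - P.xbar) a * P.L) := by gcongr; exact hg.norm_le s _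
      _ = _ := by ring
  refine (norm_ballProj_sub_le _ hr _ _).trans ?_
  rw [sub_sub_sub_comm]
  refine (norm_sub_le _ _).trans ?_
  gcongr
  exact (norm_sub_le _ _).trans (add_le_add (hest s y) (hest s' y'))

/-- The recursion for the `L^{2m}` distance: each step either adds a constant or multiplies by a
factor close to `1`. -/
theorem lintegral_norm_innerIter_sub_pow_le (hr : 0 ≤ P.r) (hρ : 0 < P.ρ) (hL : 0 ≤ P.L)
    (hg : IsOracle P.L g) [NeZero n] (hD : ∀ a, a ≠ 0 → D a = D' a) (hη : 0 ≤ P.ηi i) {m : ℕ}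
    (hm : 1 ≤ m) {R : ℝ} (hrR : P.r ≤ R) (hκm : P.ηi i * P.L / P.ρ * (2 * m + 2) ≤ 1 / 4)
    (hRm : (2 * m + 4) * (R / P.ρ) ≤ 1 / 6) {y0 : E d} (hy0 : ‖y0 - P.xbar‖ ≤ R) (j : ℕ) :
    ∫⁻ ξ, ENNReal.ofReal (‖innerIter P g D z i y0 ξ j - innerIter P g D' z i y0 ξ j‖ ^ (2 * m))
        ∂Measure.infinitePi (fun _ : ℕ => gauss d P.ρ) ≤
      ENNReal.ofReal (((1 + 500 * m ^ 2 * (P.ηi i * P.L / P.ρ) ^ 2) ^ j *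
        (4 * (P.ηi i * P.L) * ((Finset.Icc 1 j).filter fun l => z i l = 0).card)) ^ (2 * m)) := by
  set ε : ℝ := 500 * m ^ 2 * (P.ηi i * P.L / P.ρ) ^ 2 with hε
  have hε0 : 0 ≤ ε := by positivity
  have hηL : 0 ≤ P.ηi i * P.L := by positivity
  induction j with
  | zero =>
    have : 2 * m ≠ 0 := by omega
    simp [innerIter, this]
  | succ j ih =>
    have hmeasIter : ∀ D : Fin n → S, Measurable fun ξ => innerIter P g D z i y0 ξ j := fun D =>
      (measurable_innerIter hr hg j).comp measurable_prodMk_left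
    have hpair : Measurable fun ξ : ℕ → E d =>
        (innerIter P g D z i y0 ξ j, innerIter P g D' z i y0 ξ j) :=
      (hmeasIter D).prodMk (hmeasIter D')
    have hupd : ∀ (ξ : ℕ → E d) (a : E d),
        (innerIter P g D z i y0 (Function.update ξ (j + 1) a) j,
          innerIter P g D' z i y0 (Function.update ξ (j + 1) a) j) =
        (innerIter P g D z i y0 ξ j, innerIter P g D' z i y0 ξ j) := fun ξ a => by
      rw [innerIter_update y0 ξ (Nat.lt_succ_self j), innerIter_update y0 ξ (Nat.lt_succ_self j)]
    have hcard : ((Finset.Icc 1 (j + 1)).filter fun l => z i l = 0).card =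
        ((Finset.Icc 1 j).filter fun l => z i l = 0).card + if z i (j + 1) = 0 then 1 else 0 := by
      rw [← Finset.insert_Icc_right_eq_Icc_add_one (by omega : 1 ≤ j + 1), Finset.filter_insert]
      split_ifs with h
      · rw [Finset.card_insert_of_notMem (by simp)]
      · rw [add_zero]
    set c := ((Finset.Icc 1 j).filter fun l => z i l = 0).card with hc
    -- If entry `0` is sampled, the oracles may differ, and each of the two gradient steps is
    -- bounded separately: its `L^{2m}` norm is at most `2 η_i L`, so Minkowski adds `4 η_i L`.
    -- Otherwise, given the past, the common-step estimate applies to the fresh sample `ξ (j + 1)`.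
    by_cases h0 : z i (j + 1) = 0
    · rw [hcard, if_pos h0]
      have hmw : ∀ D : Fin n → S, Measurable fun ξ : ℕ → E d =>
          P.ηi i * P.L * weight P.ρ (innerIter P g D z i y0 ξ j - P.xbar) (ξ (j + 1)) := fun D =>
        ((measurable_weight P.ρ).comp (((hmeasIter D).sub_const P.xbar).prodMk
          (measurable_pi_apply (j + 1)))).const_mul _
      have hw0 : ∀ (D : Fin n → S) (ξ : ℕ → E d), 0 ≤
          P.ηi i * P.L * weight P.ρ (innerIter P g D z i y0 ξ j - P.xbar) (ξ (j + 1)) :=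
        fun D ξ => mul_nonneg hηL (weight_pos hρ _ _).le
      have hw : ∀ D : Fin n → S, ∫⁻ ξ, ENNReal.ofReal
          ((P.ηi i * P.L * weight P.ρ (innerIter P g D z i y0 ξ j - P.xbar) (ξ (j + 1))) ^ (2 * m))
          ∂Measure.infinitePi (fun _ : ℕ => gauss d P.ρ) ≤
          ENNReal.ofReal ((P.ηi i * P.L * 2) ^ (2 * m)) := fun D => by
        have hF : Measurable fun p : E d × E d => ENNReal.ofReal
            ((P.ηi i * P.L * weight P.ρ (p.1 - P.xbar) p.2) ^ (2 * m)) :=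
          ((((measurable_weight P.ρ).comp ((measurable_fst.sub_const P.xbar).prodMk
            measurable_snd)).const_mul _).pow_const _).ennreal_ofReal
        rw [lintegral_infinitePi_resample (gauss d P.ρ) (j + 1) (hmeasIter D)
          (fun ξ a => innerIter_update y0 ξ (Nat.lt_succ_self j) a) hF]
        refine (lintegral_mono fun ξ => lintegral_weight_pow_le hρ hηL
          (norm_innerIter_sub_le hr hrR hy0 ξ j) hm hRm).trans ?_
        simp
      have hsum := lintegral_add_pow_le (hmw D) (hmw D') (hw0 D) (hw0 D') (by positivity)
        (by positivity) (by omega : 1 ≤ 2 * m) (hw D) (hw D')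
      have hsum2 := lintegral_add_pow_le (((hmeasIter D).sub (hmeasIter D')).norm)
        ((hmw D).add (hmw D')) (fun ξ => norm_nonneg _)
        (fun ξ => add_nonneg (hw0 D ξ) (hw0 D' ξ)) (by positivity) (by positivity)
        (by omega : 1 ≤ 2 * m) ih hsum
      refine (lintegral_mono fun ξ => ENNReal.ofReal_le_ofReal ?_).trans
        (hsum2.trans (ENNReal.ofReal_le_ofReal ?_))
      · exact pow_le_pow_left₀ (norm_nonneg _)
          (norm_projStep_sub_le hr hρ hg hη _ _ _ _ (ξ (j + 1))) _
      · refine pow_le_pow_left₀ (by positivity) ?_ _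
        have h1 : (1 : ℝ) ≤ (1 + ε) ^ (j + 1) := one_le_pow₀ (by linarith)
        have h2 : (1 + ε) ^ j ≤ (1 + ε) ^ (j + 1) :=
          pow_le_pow_right₀ (by linarith) (Nat.le_succ j)
        have h3 : (1 + ε) ^ j * (4 * (P.ηi i * P.L) * c) ≤
            (1 + ε) ^ (j + 1) * (4 * (P.ηi i * P.L) * c) := by gcongr
        push_cast
        nlinarith
    · rw [hcard, if_neg h0, add_zero]
      have hs := hD _ h0
      have hF : Measurable fun p : (E d × E d) × E d => ENNReal.ofReal
          (‖ballProj P.xbar P.r (p.1.1 - P.ηi i • estimator P.xbar P.ρ (g (D (z i (j + 1)))) p.2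
              p.1.1) -
            ballProj P.xbar P.r (p.1.2 - P.ηi i • estimator P.xbar P.ρ (g (D (z i (j + 1)))) p.2
              p.1.2)‖ ^ (2 * m)) :=
        (((measurable_projStep hr hg (measurable_fst.comp measurable_fst) measurable_snd _ _).sub
          (measurable_projStep hr hg (measurable_snd.comp measurable_fst) measurable_snd _
            _)).norm.pow_const _).ennreal_ofReal
      have key := lintegral_infinitePi_resample (gauss d P.ρ) (j + 1) hpair hupd hF
      simp only [innerIter, ← hs]
      refine key.le.trans ?_
      refine (lintegral_mono fun ξ => lintegral_common_projStep_le hr hρ hL hg hη m hκm hRm _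
        (norm_innerIter_sub_le hr hrR hy0 ξ j) (norm_innerIter_sub_le hr hrR hy0 ξ j)).trans ?_
      rw [← hε]
      simp_rw [ENNReal.ofReal_mul (by positivity : 0 ≤ 1 + ε)]
      have hdist : Measurable fun ξ => ENNReal.ofReal
          (‖innerIter P g D z i y0 ξ j - innerIter P g D' z i y0 ξ j‖ ^ (2 * m)) :=
        (((hmeasIter D).sub (hmeasIter D')).norm.pow_const _).ennreal_ofReal
      rw [lintegral_const_mul _ hdist]
      refine (mul_le_mul_right ih _).trans ?_
      rw [← ENNReal.ofReal_mul (by positivity)]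
      refine ENNReal.ofReal_le_ofReal ?_
      rw [pow_succ' _ j, mul_assoc (1 + ε), mul_pow (1 + ε)]
      gcongr
      -- The `2m`-th moment gains only a factor `1 + ε`, whereas the bound leaves room for `(1 + ε)
      -- ^ (2m)`.
      exact le_self_pow₀ (by linarith) (by omega)

theorem innerIter_congr (hD : ∀ j, 1 ≤ j → j ≤ P.Ti i → D (z i j) = D' (z i j)) (y0 : E d)
    (ξ : ℕ → E d) {j : ℕ} (hj : j ≤ P.Ti i) :
    innerIter P g D z i y0 ξ j = innerIter P g D' z i y0 ξ j := by
  induction j with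
  | zero => rfl
  | succ j ih => simp only [innerIter, ih (by omega), hD (j + 1) (by omega) hj]

theorem innerAvg_congr (hD : ∀ j, 1 ≤ j → j ≤ P.Ti i → D (z i j) = D' (z i j)) (y0 : E d)
    (ξ : ℕ → E d) : innerAvg P g D z i y0 ξ = innerAvg P g D' z i y0 ξ := by
  unfold innerAvg
  congr 1
  exact Finset.sum_congr rfl fun j hj => innerIter_congr hD y0 ξ (Finset.mem_Icc.1 hj).2

/-- Jensen carries the moment bound from the iterates to their average; Markov at ten times the
`L^{2m}` bound then gives `10 ^ (-2m)`. -/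
theorem measure_innerAvg_sub_gt_le (hr : 0 ≤ P.r) (hρ : 0 < P.ρ) (hL : 0 < P.L)
    (hg : IsOracle P.L g) [NeZero n] (hD : ∀ a, a ≠ 0 → D a = D' a) (hη : 0 < P.ηi i)
    (hTi : 1 ≤ P.Ti i) {m : ℕ} (hm : 1 ≤ m) {R : ℝ} (hrR : P.r ≤ R)
    (hκm : P.ηi i * P.L / P.ρ * (2 * m + 2) ≤ 1 / 4)
    (hκT : P.Ti i * (500 * m ^ 2 * (P.ηi i * P.L / P.ρ) ^ 2) ≤ 1 / 10)
    (hRm : (2 * m + 4) * (R / P.ρ) ≤ 1 / 6) {y0 : E d} (hy0 : ‖y0 - P.xbar‖ ≤ R) :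
    Measure.infinitePi (fun _ : ℕ => gauss d P.ρ)
      {ξ | 50 * (P.ηi i * P.L) * ((Finset.Icc 1 (P.Ti i)).filter fun l => z i l = 0).card <
        ‖innerAvg P g D z i y0 ξ - innerAvg P g D' z i y0 ξ‖} ≤
      ENNReal.ofReal ((1 / 100) ^ m) := by
  set b := ((Finset.Icc 1 (P.Ti i)).filter fun l => z i l = 0).card with hb
  -- For `b = 0` the threshold vanishes and Markov is useless, but then the two runs coincide.
  rcases Nat.eq_zero_or_pos b with hb0 | hbpos
  · have hne : ∀ j, 1 ≤ j → j ≤ P.Ti i → D (z i j) = D' (z i j) := fun j h1 h2 => by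
      refine hD _ fun h => ?_
      have := Finset.filter_eq_empty_iff.1 (Finset.card_eq_zero.1 hb0) (Finset.mem_Icc.2 ⟨h1, h2⟩)
      exact this h
    simp_rw [innerAvg_congr hne]
    simp [hb0]
  -- The constant `5` is the increment `4` times the accumulated growth `exp (1/10) ≤ 5/4`.
  set c := 5 * (P.ηi i * P.L) * b with hc
  have hb' : (0 : ℝ) < b := by exact_mod_cast hbpos
  have hcpos : 0 < c := by positivity
  have hM : (0 : ℝ) < P.Ti i := by exact_mod_cast hTi
  set M := P.Ti i with hMdef
  set ε : ℝ := 500 * m ^ 2 * (P.ηi i * P.L / P.ρ) ^ 2 with hε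
  have hε0 : 0 ≤ ε := by positivity
  have hgrow : ∀ j ≤ M, (1 + ε) ^ j ≤ 5 / 4 := fun j hj => by
    have h1 : (1 + ε) ^ j ≤ Real.exp (1 / 10) := by
      calc (1 + ε) ^ j ≤ (1 + ε) ^ M := pow_le_pow_right₀ (by linarith) hj
        _ ≤ Real.exp ε ^ M := by gcongr; linarith [Real.add_one_le_exp ε]
        _ = Real.exp (M * ε) := (Real.exp_nat_mul _ _).symm
        _ ≤ _ := Real.exp_le_exp.2 hκT
    refine h1.trans (le_of_pow_le_pow_left₀ (n := 10) (by norm_num) (by norm_num) ?_)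
    rw [← Real.exp_nat_mul]; norm_num; linarith [Real.exp_one_lt_d9]
  have hmom : ∀ j ∈ Finset.Icc 1 M, ∫⁻ ξ, ENNReal.ofReal
      (‖innerIter P g D z i y0 ξ j - innerIter P g D' z i y0 ξ j‖ ^ (2 * m))
      ∂Measure.infinitePi (fun _ : ℕ => gauss d P.ρ) ≤ ENNReal.ofReal (c ^ (2 * m)) := fun j hj => by
    refine (lintegral_norm_innerIter_sub_pow_le hr hρ hL.le hg hD hη.le hm hrR hκm hRm hy0
      j).trans (ENNReal.ofReal_le_ofReal (pow_le_pow_left₀ (by positivity) ?_ _))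
    have hjM := (Finset.mem_Icc.1 hj).2
    have hcard : (((Finset.Icc 1 j).filter fun l => z i l = 0).card : ℝ) ≤ b := by
      exact_mod_cast Finset.card_le_card
        (Finset.filter_subset_filter _ (Finset.Icc_subset_Icc_right hjM))
    calc (1 + ε) ^ j * (4 * (P.ηi i * P.L) * ((Finset.Icc 1 j).filter fun l => z i l = 0).card)
        ≤ 5 / 4 * (4 * (P.ηi i * P.L) * b) := by
          gcongr
          exact hgrow j hjM
      _ = c := by rw [hc]; ring
  have hmeasIter : ∀ (D : Fin n → S) (j : ℕ), Measurable fun ξ => innerIter P g D z i y0 ξ j :=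
    fun D j => (measurable_innerIter hr hg j).comp measurable_prodMk_left
  have hmeasAvg : ∀ D : Fin n → S, Measurable fun ξ => innerAvg P g D z i y0 ξ :=
    fun D => (measurable_innerAvg hr hg).comp measurable_prodMk_left
  have hpt : ∀ ξ, ‖innerAvg P g D z i y0 ξ - innerAvg P g D' z i y0 ξ‖ ^ (2 * m) ≤
      ∑ j ∈ Finset.Icc 1 M, 1 / (M : ℝ) *
        ‖innerIter P g D z i y0 ξ j - innerIter P g D' z i y0 ξ j‖ ^ (2 * m) := fun ξ => by
    have h1 : ‖innerAvg P g D z i y0 ξ - innerAvg P g D' z i y0 ξ‖ ≤ ∑ j ∈ Finset.Icc 1 M,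
        1 / (M : ℝ) * ‖innerIter P g D z i y0 ξ j - innerIter P g D' z i y0 ξ j‖ := by
      unfold innerAvg
      rw [← smul_sub, ← Finset.sum_sub_distrib, norm_smul, Real.norm_eq_abs,
        abs_of_pos (by positivity), ← Finset.mul_sum]
      gcongr
      exact norm_sum_le _ _
    refine (pow_le_pow_left₀ (norm_nonneg _) h1 _).trans ?_
    refine Real.pow_arith_mean_le_arith_mean_pow _ _ _ (fun j _ => by positivity) ?_
      (fun j _ => norm_nonneg _) _
    simp [hM.ne']
  have hint : ∫⁻ ξ, ENNReal.ofReal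
      (‖innerAvg P g D z i y0 ξ - innerAvg P g D' z i y0 ξ‖ ^ (2 * m))
      ∂Measure.infinitePi (fun _ : ℕ => gauss d P.ρ) ≤ ENNReal.ofReal (c ^ (2 * m)) := by
    refine (lintegral_mono fun ξ => ENNReal.ofReal_le_ofReal (hpt ξ)).trans ?_
    have hsplit : ∀ ξ, ENNReal.ofReal (∑ j ∈ Finset.Icc 1 M, 1 / (M : ℝ) *
        ‖innerIter P g D z i y0 ξ j - innerIter P g D' z i y0 ξ j‖ ^ (2 * m)) =
        ∑ j ∈ Finset.Icc 1 M, ENNReal.ofReal (1 / (M : ℝ)) * ENNReal.ofReal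
          (‖innerIter P g D z i y0 ξ j - innerIter P g D' z i y0 ξ j‖ ^ (2 * m)) := fun ξ => by
      rw [ENNReal.ofReal_sum_of_nonneg fun j _ => by positivity]
      exact Finset.sum_congr rfl fun j _ => ENNReal.ofReal_mul (by positivity)
    simp_rw [hsplit]
    have hdist : ∀ j, Measurable fun ξ => ENNReal.ofReal
        (‖innerIter P g D z i y0 ξ j - innerIter P g D' z i y0 ξ j‖ ^ (2 * m)) := fun j =>
      (((hmeasIter D j).sub (hmeasIter D' j)).norm.pow_const _).ennreal_ofReal
    rw [lintegral_finsetSum _ fun j _ => (hdist j).const_mul _]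
    refine (Finset.sum_le_sum fun j hj => (lintegral_const_mul _ (hdist j)).le.trans
      (mul_le_mul_right (hmom j hj) _)).trans (le_of_eq ?_)
    rw [Finset.sum_const, Nat.card_Icc, Nat.add_sub_cancel, nsmul_eq_mul, ← mul_assoc,
      ← ENNReal.ofReal_natCast, ← ENNReal.ofReal_mul hM.le, mul_one_div_cancel hM.ne',
      ENNReal.ofReal_one, one_mul]
  have hmarkov := mul_meas_ge_le_lintegral (μ := Measure.infinitePi (fun _ : ℕ => gauss d P.ρ))
    (((hmeasAvg D).sub (hmeasAvg D')).norm.pow_const (2 * m)).ennreal_ofReal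
    (ENNReal.ofReal ((10 * c) ^ (2 * m)))
  have hsub : {ξ | 50 * (P.ηi i * P.L) * b <
      ‖innerAvg P g D z i y0 ξ - innerAvg P g D' z i y0 ξ‖} ⊆
      {ξ | ENNReal.ofReal ((10 * c) ^ (2 * m)) ≤ ENNReal.ofReal
        (‖innerAvg P g D z i y0 ξ - innerAvg P g D' z i y0 ξ‖ ^ (2 * m))} := fun ξ hξ => by
    have hξ' : 50 * (P.ηi i * P.L) * b <
      ‖innerAvg P g D z i y0 ξ - innerAvg P g D' z i y0 ξ‖ := hξ
    refine ENNReal.ofReal_le_ofReal (pow_le_pow_left₀ (by positivity) ?_ _)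
    rw [hc]; linarith
  refine (measure_mono hsub).trans ?_
  have hc10 : (0 : ℝ) < (10 * c) ^ (2 * m) := by positivity
  rw [← ENNReal.mul_le_mul_iff_right (ENNReal.ofReal_pos.2 hc10).ne' ENNReal.ofReal_ne_top,
    ← ENNReal.ofReal_mul hc10.le]
  refine (hmarkov.trans hint).trans (ENNReal.ofReal_le_ofReal (le_of_eq ?_))
  rw [pow_mul, pow_mul, ← mul_pow]
  congr 1; ring

end InnerLoop

/-! ### Tail of the Gaussian norm -/

theorem pow_le_pow_mul_exp {t : ℝ} (ht : 0 ≤ t) {n : ℕ} (hn : 1 ≤ n) :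
    t ^ n ≤ (n : ℝ) ^ n * Real.exp t := by
  have hn0 : (0 : ℝ) < n := by exact_mod_cast hn
  have h1 : t / n ≤ Real.exp (t / n) := by linarith [Real.add_one_le_exp (t / n)]
  have h2 := pow_le_pow_left₀ (by positivity) h1 n
  rw [← Real.exp_nat_mul, mul_div_cancel₀ _ hn0.ne', div_pow, div_le_iff₀ (by positivity)] at h2
  linarith

/-- The power mean inequality reduces the norm to single coordinates, and `t ^ (2m) ≤ (2m) ^ (2m)
exp t` reduces powers to exponentials. The scale `4√d / r` makes the rescaled coordinate of
deviation at most `1` when `σ √d ≤ r / 4`. -/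
theorem norm_pow_le_avg_exp {d : ℕ} (hd : 0 < d) {r : ℝ} (hr : 0 < r) {m : ℕ} (hm : 1 ≤ m)
    (ζ : E d) :
    ‖ζ‖ ^ (2 * m) ≤ ∑ l : Fin d, (m * r / 2) ^ (2 * m) * (1 / d) *
      Real.exp |inner ℝ (EuclideanSpace.single l (4 * √(d : ℝ) / r) : E d) ζ| := by
  have hd0 : (0 : ℝ) < d := by exact_mod_cast hd
  have hsq : √(d : ℝ) ^ 2 = d := Real.sq_sqrt hd0.le
  have hinner : ∀ l : Fin d, inner ℝ (EuclideanSpace.single l (4 * √(d : ℝ) / r) : E d) ζ =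
      4 * √(d : ℝ) / r * ζ l := fun l => by
    rw [EuclideanSpace.inner_single_left]; simp
  have h1 : ‖ζ‖ ^ 2 = (r / 4) ^ 2 * ∑ l : Fin d, 1 / (d : ℝ) * (4 * √(d : ℝ) / r * ζ l) ^ 2 := by
    rw [EuclideanSpace.real_norm_sq_eq, Finset.mul_sum]
    refine Finset.sum_congr rfl fun l _ => ?_
    have e : (4 * √(d : ℝ) / r * ζ l) ^ 2 = 16 * d / r ^ 2 * ζ l ^ 2 := by
      rw [mul_pow, div_pow, mul_pow, hsq]; ring
    rw [e]; field_simp; norm_num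
  have h2 := Real.pow_arith_mean_le_arith_mean_pow Finset.univ (fun _ : Fin d => 1 / (d : ℝ))
    (fun l => (4 * √(d : ℝ) / r * ζ l) ^ 2) (fun _ _ => by positivity)
    (by simp [hd0.ne']) (fun _ _ => sq_nonneg _) m
  calc ‖ζ‖ ^ (2 * m) = ((r / 4) ^ 2) ^ m *
        (∑ l : Fin d, 1 / (d : ℝ) * (4 * √(d : ℝ) / r * ζ l) ^ 2) ^ m := by
        rw [pow_mul, h1, mul_pow]
    _ ≤ ((r / 4) ^ 2) ^ m * ∑ l : Fin d, 1 / (d : ℝ) * ((4 * √(d : ℝ) / r * ζ l) ^ 2) ^ m := by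
        gcongr
    _ ≤ ((r / 4) ^ 2) ^ m * ∑ l : Fin d, 1 / (d : ℝ) *
        (((2 * m : ℕ) : ℝ) ^ (2 * m) * Real.exp |4 * √(d : ℝ) / r * ζ l|) := by
        gcongr with l
        rw [← pow_mul, ← Even.pow_abs (even_two_mul m)]
        exact pow_le_pow_mul_exp (abs_nonneg _) (by omega)
    _ = _ := by
        rw [Finset.mul_sum]
        refine Finset.sum_congr rfl fun l _ => ?_
        rw [hinner, ← pow_mul]
        have : (m * r / 2) ^ (2 * m) = (r / 4) ^ (2 * m) * ((2 * m : ℕ) : ℝ) ^ (2 * m) := by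
          rw [← mul_pow]; congr 1; push_cast; ring
        rw [this]; ring

/-- Markov for the `2m`-th moment: `m r / 2` against the level `3 m r` gives `6 ^ (-2m)`, and the
factor `4` bounds `2 exp (1/2)`. -/
theorem gauss_norm_gt_le {d : ℕ} (hd : 0 < d) {σ r : ℝ} (hσ : 0 < σ) (hr : 0 < r)
    (hσr : σ * √(d : ℝ) ≤ r / 4) {m : ℕ} (hm : 1 ≤ m) :
    gauss d σ {ζ | 3 * m * r < ‖ζ‖} ≤ ENNReal.ofReal (4 * (1 / 36) ^ m) := by
  have hd0 : (0 : ℝ) < d := by exact_mod_cast hd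
  have hm0 : (0 : ℝ) < m := by exact_mod_cast hm
  set c : ℝ := (m * r / 2) ^ (2 * m) * (1 / d) with hc
  have hc0 : 0 ≤ c := by positivity
  have hexp : Real.exp (1 / 2) ≤ 2 := by
    refine le_of_pow_le_pow_left₀ (n := 2) two_ne_zero (by norm_num) ?_
    rw [← Real.exp_nat_mul]; norm_num; linarith [Real.exp_one_lt_d9]
  have hcoord : ∀ l : Fin d, ∫⁻ ζ, ENNReal.ofReal
      (c * Real.exp |inner ℝ (EuclideanSpace.single l (4 * √(d : ℝ) / r) : E d) ζ|) ∂gauss d σ ≤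
      ENNReal.ofReal (c * 4) := fun l => by
    simp_rw [ENNReal.ofReal_mul hc0]
    rw [lintegral_const_mul _ (by fun_prop)]
    gcongr
    refine (lintegral_exp_abs_inner_le hσ _ (s := 1) ?_).trans (ENNReal.ofReal_le_ofReal ?_)
    · rw [PiLp.norm_single, Real.norm_eq_abs, abs_of_nonneg (by positivity)]
      have : σ * (4 * √(d : ℝ) / r) = 4 * (σ * √(d : ℝ)) / r := by ring
      rw [this, div_le_one hr]; linarith
    · norm_num at hexp ⊢; linarith
  have hint : ∫⁻ ζ, ENNReal.ofReal (‖ζ‖ ^ (2 * m)) ∂gauss d σ ≤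
      ENNReal.ofReal ((m * r / 2) ^ (2 * m) * 4) := by
    refine (lintegral_mono fun ζ =>
      ENNReal.ofReal_le_ofReal (norm_pow_le_avg_exp hd hr hm ζ)).trans ?_
    rw [← hc]
    have hsplit : ∀ ζ : E d, ENNReal.ofReal (∑ l : Fin d, c *
        Real.exp |inner ℝ (EuclideanSpace.single l (4 * √(d : ℝ) / r) : E d) ζ|) =
        ∑ l : Fin d, ENNReal.ofReal (c *
        Real.exp |inner ℝ (EuclideanSpace.single l (4 * √(d : ℝ) / r) : E d) ζ|) := fun ζ =>
      ENNReal.ofReal_sum_of_nonneg fun l _ => by positivity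
    simp_rw [hsplit]
    rw [lintegral_finsetSum _ fun l _ => by fun_prop]
    refine (Finset.sum_le_sum fun l _ => hcoord l).trans (le_of_eq ?_)
    rw [Finset.sum_const, Finset.card_univ, Fintype.card_fin, nsmul_eq_mul,
      ← ENNReal.ofReal_natCast, ← ENNReal.ofReal_mul hd0.le]
    congr 1
    rw [hc]; field_simp
  have hmarkov := mul_meas_ge_le_lintegral (μ := gauss d σ) (f := fun ζ =>
    ENNReal.ofReal (‖ζ‖ ^ (2 * m))) (by fun_prop) (ENNReal.ofReal ((3 * m * r) ^ (2 * m)))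
  have hsub : {ζ : E d | 3 * m * r < ‖ζ‖} ⊆
      {ζ | ENNReal.ofReal ((3 * m * r) ^ (2 * m)) ≤ ENNReal.ofReal (‖ζ‖ ^ (2 * m))} := fun ζ hζ =>
    ENNReal.ofReal_le_ofReal (pow_le_pow_left₀ (by positivity) (le_of_lt hζ) _)
  refine (measure_mono hsub).trans ?_
  have h0 : (0 : ℝ) < (3 * m * r) ^ (2 * m) := by positivity
  rw [← ENNReal.mul_le_mul_iff_right (ENNReal.ofReal_pos.2 h0).ne' ENNReal.ofReal_ne_top,
    ← ENNReal.ofReal_mul h0.le]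
  refine (hmarkov.trans hint).trans (ENNReal.ofReal_le_ofReal (le_of_eq ?_))
  rw [mul_left_comm, mul_comm _ (4 : ℝ)]
  congr 1
  rw [pow_mul, pow_mul, ← mul_pow]
  congr 1; ring

/-! ### Noisy Markov chains -/

section TV

variable {Ω Ω' : Type*} [MeasurableSpace Ω] [MeasurableSpace Ω'] {μ ν : Measure Ω} {e : ℝ≥0∞}

theorem TVBound.prod (h : TVBound e μ ν) [SFinite μ] [SFinite ν] (κ : Measure Ω')
    [IsProbabilityMeasure κ] : TVBound e (μ.prod κ) (ν.prod κ) := by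
  intro u hu hu1
  rw [lintegral_prod _ hu.aemeasurable, lintegral_prod _ hu.aemeasurable]
  refine h _ hu.lintegral_prod_right' fun x => ?_
  exact (lintegral_mono fun y => hu1 (x, y)).trans (by simp)

theorem TVBound.map (h : TVBound e μ ν) {f : Ω → Ω'} (hf : Measurable f) :
    TVBound e (μ.map f) (ν.map f) := by
  intro u hu hu1
  rw [lintegral_map hu hf, lintegral_map hu hf]
  exact h _ (hu.comp hf) fun x => hu1 _

theorem TVBound.trans {τ : Measure Ω} {e' : ℝ≥0∞} (h : TVBound e μ ν) (h' : TVBound e' ν τ) :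
    TVBound (e + e') μ τ := by
  intro u hu hu1
  refine (h u hu hu1).trans ?_
  rw [add_comm e, ← add_assoc]
  gcongr
  exact h' u hu hu1

/-- A coupling bound: off `s` the images agree, and on `s` the test function is at most `1`. -/
theorem tvBound_map_map {f g : Ω → Ω'} (hf : Measurable f) (hg : Measurable g) {s : Set Ω}
    (hs : MeasurableSet s) (hfg : ∀ x, x ∉ s → f x = g x) :
    TVBound (μ s) (μ.map f) (μ.map g) := by
  intro u hu hu1
  rw [lintegral_map hu hf, lintegral_map hu hg, ← lintegral_indicator_one hs,
    ← lintegral_add_left (f := fun x => u (g x)) (hu.comp hg)]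
  refine lintegral_mono fun x => ?_
  by_cases hx : x ∈ s
  · simpa [hx] using (hu1 (f x)).trans le_add_self
  · simp [hx, hfg x hx]

end TV

/-- The law of the chain `x_i = F_i(x_{i-1}, ξ_i) + ζ_i` started at `x0`, with fresh independent
Gaussian sequences `ξ_i` of scale `ρ` and Gaussian noises `ζ_i` of scale `σ i`. -/
noncomputable def chainLaw {d : ℕ} (x0 : E d) (ρ : ℝ) (σ : ℕ → ℝ)
    (F : ℕ → E d → (ℕ → E d) → E d) : ℕ → Measure (E d)
  | 0 => Measure.dirac x0
  | i + 1 =>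
      ((chainLaw x0 ρ σ F i).prod
        ((Measure.infinitePi fun _ : ℕ => gauss d ρ).prod (gauss d (σ (i + 1))))).map
        fun ω => F (i + 1) ω.1 ω.2.1 + ω.2.2

/-- The hybrid is not a run of the solver on any dataset; the two are compared as instances of one
kind of chain. -/
theorem outerLaw_eq_chainLaw {d n : ℕ} {S : Type*} (P : Params d) (g : S → E d → E d)
    (D : Fin n → S) (z : ℕ → ℕ → Fin n) (i : ℕ) :
    outerLaw P g D z i = chainLaw P.xbar P.ρ P.σi (innerAvg P g D z) i := by
  induction i with
  | zero => rfl
  | succ i ih => rw [outerLaw, ih]; rfl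

section Chain

variable {d : ℕ} {x0 : E d} {ρ : ℝ} {σ : ℕ → ℝ} {F G : ℕ → E d → (ℕ → E d) → E d}

theorem isProbabilityMeasure_chainLaw
    (hF : ∀ i, Measurable fun p : E d × (ℕ → E d) => F i p.1 p.2) (i : ℕ) :
    IsProbabilityMeasure (chainLaw x0 ρ σ F i) := by
  induction i with
  | zero => unfold chainLaw; infer_instance
  | succ i ih =>
    unfold chainLaw
    have h1 : Measurable fun ω : E d × (ℕ → E d) × E d => F (i + 1) ω.1 ω.2.1 :=
      (hF (i + 1)).comp (measurable_fst.prodMk (measurable_fst.comp measurable_snd))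
    exact Measure.isProbabilityMeasure_map
      (h1.add (measurable_snd.comp measurable_snd)).aemeasurable

theorem chainLaw_succ (hF : ∀ i, Measurable fun p : E d × (ℕ → E d) => F i p.1 p.2) (i : ℕ) :
    chainLaw x0 ρ σ F (i + 1) =
      (((chainLaw x0 ρ σ F i).prod (Measure.infinitePi fun _ : ℕ => gauss d ρ)).prod
        (gauss d (σ (i + 1)))).map fun p => F (i + 1) p.1.1 p.1.2 + p.2 := by
  have := isProbabilityMeasure_chainLaw (x0 := x0) (ρ := ρ) (σ := σ) hF i
  have h1 : Measurable fun ω : E d × (ℕ → E d) × E d => F (i + 1) ω.1 ω.2.1 + ω.2.2 :=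
    ((hF (i + 1)).comp (measurable_fst.prodMk (measurable_fst.comp measurable_snd))).add
      (measurable_snd.comp measurable_snd)
  rw [chainLaw, ← Measure.prodAssoc_prod, Measure.map_map h1 (MeasurableEquiv.measurable _)]
  rfl

/-- In each loop the `ξ`-samples are shared and free, and the noise pays for the shift. The bound on
the shift has to hold for every `x` and `ξ`, which is why the hybrid chain is introduced. -/
theorem holderDom_chainLaw {α q : ℝ} (hq : α.HolderConjugate q)
    (hF : ∀ i, Measurable fun p : E d × (ℕ → E d) => F i p.1 p.2)
    (hG : ∀ i, Measurable fun p : E d × (ℕ → E d) => G i p.1 p.2) {Δ : ℕ → ℝ}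
    (hΔ : ∀ i x ξ, ‖F i x ξ - G i x ξ‖ ≤ Δ i) (k : ℕ) (hσ : ∀ i, 1 ≤ i → i ≤ k → 0 < σ i) :
    HolderDom q (∑ i ∈ Finset.Icc 1 k, α * Δ i ^ 2 / (2 * σ i ^ 2)) (chainLaw x0 ρ σ F k)
      (chainLaw x0 ρ σ G k) := by
  induction k with
  | zero => simpa [chainLaw] using HolderDom.refl hq (Measure.dirac x0)
  | succ k ih =>
    have := isProbabilityMeasure_chainLaw (x0 := x0) (ρ := ρ) (σ := σ) hF k
    have := isProbabilityMeasure_chainLaw (x0 := x0) (ρ := ρ) (σ := σ) hG k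
    rw [chainLaw_succ hF, chainLaw_succ hG, Finset.sum_Icc_succ_top (by omega)]
    exact ((ih fun i h1 h2 => hσ i h1 (by omega)).prod hq _).add_gauss
      (hσ (k + 1) (by omega) le_rfl) hq (hF _) (hG _) fun p => hΔ _ _ _

/-- The step of `F` is applied to both laws, and is then exchanged for that of `G` under the law of
`G`. So the bad sets are measured along `G` only, which will be the genuine solver, where tail
bounds are available. -/
theorem tvBound_chainLaw (hF : ∀ i, Measurable fun p : E d × (ℕ → E d) => F i p.1 p.2)
    (hG : ∀ i, Measurable fun p : E d × (ℕ → E d) => G i p.1 p.2) {e : ℝ≥0∞} (k : ℕ)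
    (he : ∀ i < k, ∃ s : Set (E d × (ℕ → E d)), MeasurableSet s ∧
      (∀ p, p ∉ s → F (i + 1) p.1 p.2 = G (i + 1) p.1 p.2) ∧
      ((chainLaw x0 ρ σ G i).prod (Measure.infinitePi fun _ : ℕ => gauss d ρ)) s ≤ e) :
    TVBound (k * e) (chainLaw x0 ρ σ F k) (chainLaw x0 ρ σ G k) := by
  induction k with
  | zero => simpa [chainLaw] using TVBound.refl (Measure.dirac x0)
  | succ k ih =>
    have := isProbabilityMeasure_chainLaw (x0 := x0) (ρ := ρ) (σ := σ) hF k
    have := isProbabilityMeasure_chainLaw (x0 := x0) (ρ := ρ) (σ := σ) hG k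
    rw [chainLaw_succ hF, chainLaw_succ hG]
    obtain ⟨s, hs, hFG, hse⟩ := he k (Nat.lt_succ_self k)
    have hmF : Measurable fun p : (E d × (ℕ → E d)) × E d => F (k + 1) p.1.1 p.1.2 + p.2 :=
      ((hF (k + 1)).comp measurable_fst).add measurable_snd
    have hmG : Measurable fun p : (E d × (ℕ → E d)) × E d => G (k + 1) p.1.1 p.1.2 + p.2 :=
      ((hG (k + 1)).comp measurable_fst).add measurable_snd
    have h1 := (((ih fun i hi => he i (by omega)).prod
      (Measure.infinitePi fun _ : ℕ => gauss d ρ)).prod (gauss d (σ (k + 1)))).map hmF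
    have h2 := tvBound_map_map (μ := ((chainLaw x0 ρ σ G k).prod
      (Measure.infinitePi fun _ : ℕ => gauss d ρ)).prod (gauss d (σ (k + 1)))) hmF hmG
      (hs.prod MeasurableSet.univ) (fun p hp => by
        rw [hFG p.1 fun h => hp ⟨h, Set.mem_univ _⟩])
    rw [Measure.prod_prod, measure_univ, mul_one] at h2
    refine (h1.trans h2).mono ?_
    push_cast
    rw [add_mul, one_mul]
    gcongr

end Chain

/-! ### The solver -/

section Solver

variable {d n : ℕ} {S : Type*} {P : Params d} {g : S → E d → E d} {D D' : Fin n → S}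
  {z : ℕ → ℕ → Fin n}

theorem Params.one_le_Ti {i : ℕ} (hi : i ≤ P.k) : 1 ≤ P.Ti i :=
  Nat.div_pos (Nat.pow_le_pow_right two_pos hi) (by positivity)

theorem Params.Ti_le (hT : 1 ≤ P.T) (i : ℕ) : P.Ti i ≤ P.T :=
  (Nat.div_le_self _ _).trans (Nat.pow_log_le_self 2 (by omega))

theorem Params.η_pos (hd : 0 < d) (hr : 0 < P.r) (hβ : 0 < P.β) (hL : 0 < P.L) (hT : 1 ≤ P.T) :
    0 < P.η := by
  have hd' : (0 : ℝ) < d := by exact_mod_cast hd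
  have hT' : (0 : ℝ) < P.T := by exact_mod_cast hT
  unfold Params.η
  have : 0 < min (1 / √(P.T : ℝ)) (P.β / √(d : ℝ)) := lt_min (by positivity) (by positivity)
  positivity

theorem Params.ηi_le {i : ℕ} (hi : 1 ≤ i) (hη : 0 ≤ P.η) : P.ηi i ≤ P.η / 4 := by
  unfold Params.ηi
  have : (4 : ℝ) ≤ 4 ^ i := le_self_pow₀ (by norm_num) (by omega)
  gcongr

theorem Params.ηi_mul_div_le {i : ℕ} (hi : 1 ≤ i) (hr : 0 < P.r) (hρ : 0 < P.ρ) (hL : 0 < P.L)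
    (hη : 0 ≤ P.η) : P.ηi i * P.L / P.ρ ≤ P.r / P.ρ / (4 * √(P.T : ℝ)) := by
  have h1 : P.η ≤ P.r / P.L * (1 / √(P.T : ℝ)) := by
    unfold Params.η
    gcongr
    exact min_le_left _ _
  calc P.ηi i * P.L / P.ρ ≤ (P.r / P.L * (1 / √(P.T : ℝ)) / 4) * P.L / P.ρ := by
        gcongr
        exact (P.ηi_le hi hη).trans (by gcongr)
    _ = _ := by field_simp

theorem Params.σi_mul_sqrt_le {i : ℕ} (hi : 1 ≤ i) (hd : 0 < d) (hr : 0 < P.r) (hβ : 0 < P.β)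
    (hL : 0 < P.L) (hη : 0 ≤ P.η) : P.σi i * √(d : ℝ) ≤ P.r / 4 := by
  have hd' : (0 : ℝ) < d := by exact_mod_cast hd
  have h1 : P.η ≤ P.r / P.L * (P.β / √(d : ℝ)) := by
    unfold Params.η
    gcongr
    exact min_le_right _ _
  unfold Params.σi
  calc P.L * P.ηi i / P.β * √(d : ℝ)
      ≤ P.L * (P.r / P.L * (P.β / √(d : ℝ)) / 4) / P.β * √(d : ℝ) := by
        gcongr
        exact (P.ηi_le hi hη).trans (by gcongr)
    _ = _ := by field_simp

/-- The average lies in the ball of radius `r ≤ m r`, so leaving the ball of radius `4 m r` forces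
`‖ζ_i‖ > 3 m r`. The bound `β / √d` in `η` makes `σ_i √d ≤ r / 4`. -/
theorem outerLaw_norm_gt_le (hd : 0 < d) (hr : 0 < P.r) (hβ : 0 < P.β) (hL : 0 < P.L)
    (hT : 1 ≤ P.T) (hg : IsOracle P.L g) {m : ℕ} (hm : 1 ≤ m) {i : ℕ} (hi : i ≤ P.k) :
    outerLaw P g D z i {x | 4 * m * P.r < ‖x - P.xbar‖} ≤
      ENNReal.ofReal (4 * (1 / 36) ^ m) := by
  have hη := P.η_pos hd hr hβ hL hT
  have hm' : (1 : ℝ) ≤ m := by exact_mod_cast hm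
  have hmeas : MeasurableSet {x : E d | 4 * m * P.r < ‖x - P.xbar‖} :=
    measurableSet_lt measurable_const (by fun_prop)
  cases i with
  | zero =>
    rw [outerLaw, Measure.dirac_apply' _ hmeas]
    have : P.xbar ∉ {x : E d | 4 * m * P.r < ‖x - P.xbar‖} := by
      simp only [Set.mem_ofPred_eq, sub_self, norm_zero, not_lt]
      positivity
    simp [this]
  | succ i =>
    have hprob : IsProbabilityMeasure (outerLaw P g D z i) := by
      rw [outerLaw_eq_chainLaw]
      exact isProbabilityMeasure_chainLaw (fun i => measurable_innerAvg hr.le hg) i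
    have hF : Measurable fun ω : E d × (ℕ → E d) × E d =>
        innerAvg P g D z (i + 1) ω.1 ω.2.1 + ω.2.2 :=
      ((measurable_innerAvg hr.le hg).comp
        (measurable_fst.prodMk (measurable_fst.comp measurable_snd))).add
        (measurable_snd.comp measurable_snd)
    rw [outerLaw, Measure.map_apply hF hmeas]
    have hσ : 0 < P.σi (i + 1) := by
      unfold Params.σi Params.ηi; positivity
    have hsub : (fun ω : E d × (ℕ → E d) × E d => innerAvg P g D z (i + 1) ω.1 ω.2.1 + ω.2.2) ⁻¹'
        {x | 4 * m * P.r < ‖x - P.xbar‖} ⊆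
        Set.univ ×ˢ (Set.univ ×ˢ {ζ : E d | 3 * m * P.r < ‖ζ‖}) := fun ω hω => by
      have hω' : 4 * m * P.r < ‖innerAvg P g D z (i + 1) ω.1 ω.2.1 + ω.2.2 - P.xbar‖ := hω
      refine ⟨Set.mem_univ _, Set.mem_univ _, ?_⟩
      have h1 := norm_innerAvg_sub_le (P := P) (g := g) (D := D) (z := z) hr.le (P.one_le_Ti hi)
        ω.1 ω.2.1
      rw [add_sub_right_comm] at hω'
      have h2 := norm_add_le (innerAvg P g D z (i + 1) ω.1 ω.2.1 - P.xbar) ω.2.2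
      change 3 * m * P.r < ‖ω.2.2‖
      nlinarith
    refine (measure_mono hsub).trans ?_
    rw [Measure.prod_prod, Measure.prod_prod, measure_univ, measure_univ, one_mul, one_mul]
    exact gauss_norm_gt_le hd hσ hr (P.σi_mul_sqrt_le (by omega) hd hr hβ hL hη.le) hm

/-- Splits by whether the loop starts within `R = 4 m r` of the center: the tail of the start bounds
one case, the inner-loop estimate the other. -/
theorem measure_prod_innerAvg_sub_gt_le (hd : 0 < d) (hr : 0 < P.r) (hρ : 0 < P.ρ) (hβ : 0 < P.β)
    (hL : 0 < P.L) (hT : 1 ≤ P.T) (hg : IsOracle P.L g) [NeZero n]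
    (hD : ∀ a, a ≠ 0 → D a = D' a) {m : ℕ} (hm : 1 ≤ m) (hmr : 144 * m ^ 2 * (P.r / P.ρ) ≤ 1)
    {i : ℕ} (hi : i < P.k) :
    ((outerLaw P g D' z i).prod (Measure.infinitePi fun _ : ℕ => gauss d P.ρ))
      {p | 50 * (P.ηi (i + 1) * P.L) *
          ((Finset.Icc 1 (P.Ti (i + 1))).filter fun l => z (i + 1) l = 0).card <
        ‖innerAvg P g D z (i + 1) p.1 p.2 - innerAvg P g D' z (i + 1) p.1 p.2‖} ≤
      ENNReal.ofReal (4 * (1 / 36) ^ m + (1 / 100) ^ m) := by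
  have hη := P.η_pos hd hr hβ hL hT
  have hηi : 0 < P.ηi (i + 1) := by unfold Params.ηi; positivity
  have hm' : (1 : ℝ) ≤ m := by exact_mod_cast hm
  have hT' : (1 : ℝ) ≤ P.T := by exact_mod_cast hT
  have hsT : 1 ≤ √(P.T : ℝ) := Real.one_le_sqrt.2 hT'
  have hτ0 : 0 < P.r / P.ρ := by positivity
  set τ := P.r / P.ρ with hτ
  have hκ := P.ηi_mul_div_le (i := i + 1) (by omega) hr hρ hL hη.le
  rw [← hτ] at hκ
  set κ := P.ηi (i + 1) * P.L / P.ρ with hκdef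
  have hκ0 : 0 ≤ κ := by positivity
  have hκm : κ * (2 * m + 2) ≤ 1 / 4 := by
    have h1 : κ ≤ τ / 4 := hκ.trans (by gcongr; linarith)
    have h2 : κ * (2 * m + 2) ≤ τ / 4 * (4 * m ^ 2) := by gcongr; nlinarith
    linarith
  -- The bound `1 / √T` in `η` cancels the number of steps, so the growth over a whole loop stays
  -- bounded.
  have hκT : P.Ti (i + 1) * (500 * m ^ 2 * κ ^ 2) ≤ 1 / 10 := by
    have h1 : (P.Ti (i + 1) : ℝ) ≤ P.T := by exact_mod_cast P.Ti_le hT _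
    have h2 : κ ^ 2 ≤ τ ^ 2 / (16 * P.T) := by
      calc κ ^ 2 ≤ (τ / (4 * √(P.T : ℝ))) ^ 2 := by gcongr
        _ = τ ^ 2 / (16 * √(P.T : ℝ) ^ 2) := by ring
        _ = _ := by rw [Real.sq_sqrt (by linarith)]
    have h4 : m * τ ≤ 1 / 144 := by nlinarith
    calc P.Ti (i + 1) * (500 * m ^ 2 * κ ^ 2)
        ≤ P.T * (500 * m ^ 2 * (τ ^ 2 / (16 * P.T))) := by gcongr
      _ = 500 / 16 * (m * τ) ^ 2 := by field_simp
      _ ≤ 500 / 16 * (1 / 144) ^ 2 := by gcongr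
      _ ≤ _ := by norm_num
  -- From `2m + 4 ≤ 6m` the left side is at most `24 m² τ ≤ 24 / 144`; this is the condition that
  -- fixes the constant `144`.
  have hRm : (2 * m + 4) * (4 * m * P.r / P.ρ) ≤ 1 / 6 := by
    rw [mul_div_assoc, ← hτ]
    calc (2 * m + 4) * (4 * m * τ) ≤ (6 * m) * (4 * m * τ) := by gcongr; linarith
      _ ≤ _ := by nlinarith
  have hrR : P.r ≤ 4 * m * P.r := by nlinarith
  have hmeasR : MeasurableSet {x : E d | 4 * m * P.r < ‖x - P.xbar‖} :=
    measurableSet_lt measurable_const (by fun_prop)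
  have hprob : IsProbabilityMeasure (outerLaw P g D' z i) := by
    rw [outerLaw_eq_chainLaw]
    exact isProbabilityMeasure_chainLaw (fun i => measurable_innerAvg hr.le hg) i
  have hbad : MeasurableSet {p : E d × (ℕ → E d) | 50 * (P.ηi (i + 1) * P.L) *
      ((Finset.Icc 1 (P.Ti (i + 1))).filter fun l => z (i + 1) l = 0).card <
      ‖innerAvg P g D z (i + 1) p.1 p.2 - innerAvg P g D' z (i + 1) p.1 p.2‖} :=
    measurableSet_lt measurable_const
      ((measurable_innerAvg hr.le hg).sub (measurable_innerAvg hr.le hg)).norm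
  rw [Measure.prod_apply hbad]
  calc _ ≤ ∫⁻ x, ({x : E d | 4 * m * P.r < ‖x - P.xbar‖}.indicator 1 x +
        ENNReal.ofReal ((1 / 100) ^ m)) ∂outerLaw P g D' z i := by
        refine lintegral_mono fun x => ?_
        by_cases hx : 4 * m * P.r < ‖x - P.xbar‖
        · rw [Set.indicator_of_mem (s := {x : E d | 4 * m * P.r < ‖x - P.xbar‖}) hx]
          exact prob_le_one.trans le_self_add
        · exact (measure_innerAvg_sub_gt_le hr.le hρ hL hg hD hηi (P.one_le_Ti hi) hm hrR hκm
            hκT hRm (not_lt.1 hx)).trans le_add_self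
    _ ≤ _ := by
        rw [lintegral_add_right _ measurable_const, lintegral_indicator_one hmeasR,
          lintegral_const, measure_univ, mul_one,
          ENNReal.ofReal_add (by positivity) (by positivity)]
        gcongr
        exact outerLaw_norm_gt_le hd hr hβ hL hT hg hm hi.le

/-- The inner loop on `D'`, replaced by the one on `D` where the two are more than `Δ` apart. -/
noncomputable def hybridAvg (P : Params d) (g : S → E d → E d) (D D' : Fin n → S)
    (z : ℕ → ℕ → Fin n) (Δ : ℕ → ℝ) (i : ℕ) (x : E d) (ξ : ℕ → E d) : E d :=
  if Δ i < ‖innerAvg P g D z i x ξ - innerAvg P g D' z i x ξ‖ then innerAvg P g D z i x ξ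
  else innerAvg P g D' z i x ξ

/-- The witness is the law of the hybrid chain. It departs from the chain on `D'` only on the bad
sets, and from the chain on `D` never by more than `Δ i`. -/
theorem exists_law_near_outputLaw (hd : 0 < d) (hr : 0 < P.r) (hρ : 0 < P.ρ) (hβ : 0 < P.β)
    (hL : 0 < P.L) (hT : 1 ≤ P.T) (hg : IsOracle P.L g) [NeZero n]
    (hD : ∀ a, a ≠ 0 → D a = D' a) {m : ℕ} (hm : 1 ≤ m) (hmr : 144 * m ^ 2 * (P.r / P.ρ) ≤ 1)
    {α q : ℝ} (hq : α.HolderConjugate q) :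
    ∃ ν : Measure (E d), IsProbabilityMeasure ν ∧
      TVBound (ENNReal.ofReal (P.k * (4 * (1 / 36) ^ m + (1 / 100) ^ m))) ν
        (outputLaw P g D' z) ∧
      HolderDom q (1500 * α * P.β ^ 2 * (occurrences P z 0 : ℝ) ^ 2) (outputLaw P g D z) ν := by
  set b : ℕ → ℕ := fun i => ((Finset.Icc 1 (P.Ti i)).filter fun l => z i l = 0).card with hb
  set Δ : ℕ → ℝ := fun i => 50 * (P.ηi i * P.L) * b i with hΔ
  have hη := P.η_pos hd hr hβ hL hT
  have hηi : ∀ i, 0 < P.ηi i := fun i => by unfold Params.ηi; positivity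
  have hσ : ∀ i, 0 < P.σi i := fun i => by
    unfold Params.σi
    have := hηi i
    positivity
  have hF : ∀ (D : Fin n → S) (i : ℕ), Measurable fun p : E d × (ℕ → E d) =>
      innerAvg P g D z i p.1 p.2 := fun D i => measurable_innerAvg hr.le hg
  have hset : ∀ i, MeasurableSet {p : E d × (ℕ → E d) | Δ i <
      ‖innerAvg P g D z i p.1 p.2 - innerAvg P g D' z i p.1 p.2‖} := fun i =>
    measurableSet_lt measurable_const ((hF D i).sub (hF D' i)).norm
  have hH : ∀ i, Measurable fun p : E d × (ℕ → E d) => hybridAvg P g D D' z Δ i p.1 p.2 :=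
    fun i => Measurable.ite (hset i) (hF D i) (hF D' i)
  refine ⟨chainLaw P.xbar P.ρ P.σi (hybridAvg P g D D' z Δ) P.k,
    isProbabilityMeasure_chainLaw hH _, ?_, ?_⟩
  · rw [outputLaw, outerLaw_eq_chainLaw, ENNReal.ofReal_mul (by positivity),
      ENNReal.ofReal_natCast]
    refine tvBound_chainLaw hH (hF D') P.k fun i hi => ⟨_, hset (i + 1), fun p hp => if_neg hp, ?_⟩
    rw [← outerLaw_eq_chainLaw]
    exact measure_prod_innerAvg_sub_gt_le hd hr hρ hβ hL hT hg hD hm hmr hi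
  · rw [outputLaw, outerLaw_eq_chainLaw]
    refine (holderDom_chainLaw hq (hF D) hH (Δ := Δ) (fun i x ξ => ?_) P.k
      fun i _ _ => hσ i).mono hq.symm.pos ?_
    · unfold hybridAvg
      split_ifs with h
      · rw [sub_self, norm_zero]
        have := hηi i
        positivity
      · exact not_lt.1 h
    -- Since `σ_i = L η_i / β`, the step size cancels, leaving `50² / 2 = 1250`.
    · have hterm : ∀ i, α * Δ i ^ 2 / (2 * P.σi i ^ 2) = 1250 * α * P.β ^ 2 * (b i : ℝ) ^ 2 :=
        fun i => by
          have := hηi i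
          simp only [hΔ, Params.σi]
          field_simp
          ring
      simp_rw [hterm]
      rw [← Finset.mul_sum]
      have hsq : ∑ i ∈ Finset.Icc 1 P.k, (b i : ℝ) ^ 2 ≤ (occurrences P z 0 : ℝ) ^ 2 := by
        have : (occurrences P z 0 : ℝ) = ∑ i ∈ Finset.Icc 1 P.k, (b i : ℝ) := by
          simp [occurrences, hb]
        rw [this]
        exact Finset.sum_sq_le_sq_sum_of_nonneg fun i _ => Nat.cast_nonneg _
      have hα := hq.pos
      have hαβ : 0 ≤ α * P.β ^ 2 := by positivity
      nlinarith [mul_le_mul_of_nonneg_left hsq hαβ,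
        mul_nonneg hαβ (sq_nonneg (occurrences P z 0 : ℝ))]

end Solver

/-! ### Choice of the moment order, degenerate cases and conclusion. -/

/-- The choice is `m = ⌈p⌉` with `p = log (log T / δ)`, and `1728 = 12 · 144` absorbs the rounding
through `m² ≤ 12 p²`. The squared logarithm in `hbound` is useless near `log T = δ`; `δ < 1/2` and
`T ≥ 2` keep `p` away from `0`. -/
theorem exists_moment_exponent {T : ℕ} (hT : 2 ≤ T) {δ τ : ℝ} (hδ : 0 < δ) (hδ2 : δ < 1 / 2)
    (hτ : 0 < τ) (hbound : 1728 * Real.log (Real.log T / δ) ^ 2 ≤ 1 / τ) :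
    ∃ m : ℕ, 1 ≤ m ∧ 144 * m ^ 2 * τ ≤ 1 ∧
      Nat.log 2 T * (4 * (1 / 36 : ℝ) ^ m + (1 / 100) ^ m) ≤ δ := by
  have hT' : (2 : ℝ) ≤ T := by exact_mod_cast hT
  have hl2 : 0.6931 < Real.log 2 := by linarith [Real.log_two_gt_d9]
  have hlT : Real.log 2 ≤ Real.log T := Real.log_le_log two_pos hT'
  have hlT0 : 0 < Real.log T := by linarith
  have hratio : 1.386 ≤ Real.log T / δ := by
    rw [le_div_iff₀ hδ]; nlinarith
  set p := Real.log (Real.log T / δ) with hp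
  have hexp_p : Real.exp p = Real.log T / δ := Real.exp_log (by positivity)
  -- This is the bound needed for `p ≤ 1`, where `m = 1`: `12 · 0.3² ≥ 1`.
  have hp3 : 0.3 ≤ p := by
    rw [hp, Real.le_log_iff_exp_le (by positivity)]
    refine le_trans ?_ hratio
    refine le_of_pow_le_pow_left₀ (n := 10) (by norm_num) (by norm_num) ?_
    rw [← Real.exp_nat_mul]
    have h3 : ((10 : ℕ) : ℝ) * 0.3 = (3 : ℕ) * 1 := by norm_num
    rw [h3, Real.exp_nat_mul]
    calc Real.exp 1 ^ 3 ≤ 2.72 ^ 3 := by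
          gcongr
          linarith [Real.exp_one_lt_d9]
      _ ≤ _ := by norm_num
  set m := ⌈p⌉₊ with hm
  have hm1 : 1 ≤ m := Nat.one_le_ceil_iff.2 (by linarith)
  have hpm : p ≤ m := Nat.le_ceil p
  have hmp : (m : ℝ) ^ 2 ≤ 12 * p ^ 2 := by
    rcases le_or_gt p 1 with h | h
    · have : m ≤ 1 := Nat.ceil_le.2 (by simpa using h)
      have : (m : ℝ) ≤ 1 := by exact_mod_cast this
      nlinarith [(Nat.cast_nonneg m : (0 : ℝ) ≤ m)]
    · have := Nat.ceil_lt_add_one (by linarith : 0 ≤ p)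
      rw [← hm] at this
      nlinarith [(Nat.cast_nonneg m : (0 : ℝ) ≤ m)]
  refine ⟨m, hm1, ?_, ?_⟩
  · have : 144 * (m : ℝ) ^ 2 ≤ 1 / τ := by linarith
    rwa [le_div_iff₀ hτ] at this
  · have hk : (Nat.log 2 T : ℝ) * Real.log 2 ≤ Real.log T := by
      rw [← Real.log_pow]
      refine Real.log_le_log (by positivity) ?_
      exact_mod_cast Nat.pow_log_le_self 2 (by omega : T ≠ 0)
    have he0 : 0 < Real.exp 1 := Real.exp_pos 1
    have he : Real.exp 1 ≤ 2.72 := by linarith [Real.exp_one_lt_d9]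
    have hem : Real.log T ≤ δ * Real.exp 1 ^ m := by
      have h1 : Real.log T / δ ≤ Real.exp m := hexp_p ▸ Real.exp_le_exp.2 hpm
      rw [div_le_iff₀ hδ] at h1
      rw [← Real.exp_nat_mul, mul_one]
      linarith
    -- The failure probability per loop decays faster than `e ^ (-m) ≤ δ / log T`, and the number of
    -- loops is at most `log T / log 2`.
    have hsmall : Real.exp 1 ^ m * (4 * (1 / 36 : ℝ) ^ m + (1 / 100) ^ m) ≤ Real.log 2 := by
      have h1 : (Real.exp 1 * (1 / 36)) ^ m ≤ 0.08 :=
        (pow_le_of_le_one (by positivity) (by linarith) (by omega)).trans (by linarith)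
      have h2 : (Real.exp 1 * (1 / 100)) ^ m ≤ 0.03 :=
        (pow_le_of_le_one (by positivity) (by linarith) (by omega)).trans (by linarith)
      calc Real.exp 1 ^ m * (4 * (1 / 36 : ℝ) ^ m + (1 / 100) ^ m)
          = 4 * (Real.exp 1 * (1 / 36)) ^ m + (Real.exp 1 * (1 / 100)) ^ m := by
            rw [mul_pow, mul_pow]; ring
        _ ≤ _ := by linarith
    set Q := 4 * (1 / 36 : ℝ) ^ m + (1 / 100) ^ m with hQ
    have hQ0 : 0 ≤ Q := by positivity
    refine le_of_mul_le_mul_right ?_ (by linarith : 0 < Real.log 2)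
    calc Nat.log 2 T * Q * Real.log 2 = Nat.log 2 T * Real.log 2 * Q := by ring
      _ ≤ Real.log T * Q := by gcongr
      _ ≤ δ * Real.exp 1 ^ m * Q := by gcongr
      _ = δ * (Real.exp 1 ^ m * Q) := by ring
      _ ≤ _ := by gcongr

theorem approxRenyiDiv_le_of_exists {Ω : Type*} [MeasurableSpace Ω] {α δ : ℝ} {μ ν : Measure Ω}
    {c : EReal} (h : ∃ μ' ν' : ProbabilityMeasure Ω, tvDist (μ' : Measure Ω) μ ≤ δ ∧
      tvDist (ν' : Measure Ω) ν ≤ δ ∧ renyiDiv α (μ' : Measure Ω) (ν' : Measure Ω) ≤ c) :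
    approxRenyiDiv α δ μ ν ≤ c := by
  obtain ⟨μ', ν', h1, h2, h3⟩ := h
  unfold approxRenyiDiv
  exact iInf_le_of_le μ' (iInf_le_of_le ν' (iInf_le_of_le h1 (iInf_le_of_le h2 h3)))

/-- For `δ ≥ 1/2` both laws may be replaced by their midpoint, and the divergence vanishes. -/
theorem tvBound_half_midpoint {Ω : Type*} [MeasurableSpace Ω] (μ ν : Measure Ω)
    [IsProbabilityMeasure μ] [IsProbabilityMeasure ν] :
    TVBound (ENNReal.ofReal (1 / 2)) ((2⁻¹ : ℝ≥0∞) • (μ + ν)) μ := by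
  intro u hu hu1
  rw [lintegral_smul_measure, lintegral_add_measure, smul_eq_mul, mul_add, one_div,
    ENNReal.ofReal_inv_of_pos two_pos, ENNReal.ofReal_ofNat]
  refine add_le_add ?_ ?_
  · exact mul_le_of_le_one_left' (by simp)
  · exact mul_le_of_le_one_right' ((lintegral_mono hu1).trans (by simp))

theorem isProbabilityMeasure_midpoint {Ω : Type*} [MeasurableSpace Ω] (μ ν : Measure Ω)
    [IsProbabilityMeasure μ] [IsProbabilityMeasure ν] :
    IsProbabilityMeasure ((2⁻¹ : ℝ≥0∞) • (μ + ν)) := by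
  refine ⟨?_⟩
  rw [Measure.smul_apply, Measure.add_apply, measure_univ, measure_univ, smul_eq_mul,
    one_add_one_eq_two]
  exact ENNReal.inv_mul_cancel two_ne_zero ENNReal.ofNat_ne_top

theorem exists_renyiDiv_le {d n : ℕ} [NeZero n] {S : Type*} {g : S → E d → E d} {P : Params d}
    (hr : 0 < P.r) (hρ : 0 < P.ρ) (hβ : 0 < P.β) (hL : 0 < P.L) (hT : 1 ≤ P.T)
    (hg : IsOracle P.L g) {D D' : Fin n → S} (hD : ∀ a, a ≠ 0 → D a = D' a)
    (z : ℕ → ℕ → Fin n) {δ : ℝ} (hδ : 0 < δ)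
    (hbound : 1728 * Real.log (Real.log P.T / δ) ^ 2 ≤ P.ρ / P.r) {α : ℝ} (hα : 1 < α) :
    ∃ μ' ν' : ProbabilityMeasure (E d),
      tvDist (μ' : Measure (E d)) (outputLaw P g D z) ≤ δ ∧
      tvDist (ν' : Measure (E d)) (outputLaw P g D' z) ≤ δ ∧
      renyiDiv α (μ' : Measure (E d)) (ν' : Measure (E d)) ≤
        ((1500 * α * P.β ^ 2 * (occurrences P z 0 : ℝ) ^ 2 : ℝ) : EReal) := by
  have hq : α.HolderConjugate (α / (α - 1)) := Real.HolderConjugate.conjExponent hα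
  set q := α / (α - 1)
  have hprob : ∀ D : Fin n → S, IsProbabilityMeasure (outputLaw P g D z) := fun D => by
    rw [outputLaw, outerLaw_eq_chainLaw]
    exact isProbabilityMeasure_chainLaw (fun i => measurable_innerAvg hr.le hg) _
  have hc0 : 0 ≤ 1500 * α * P.β ^ 2 * (occurrences P z 0 : ℝ) ^ 2 := by positivity
  have hself : ∀ (μ ν : Measure (E d)) [IsProbabilityMeasure μ] [IsProbabilityMeasure ν],
      μ = ν → HolderDom q (1500 * α * P.β ^ 2 * (occurrences P z 0 : ℝ) ^ 2) μ ν := by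
    rintro μ _ _ _ rfl
    exact (HolderDom.refl hq μ).mono hq.symm.pos hc0
  have htv0 : ∀ (μ ν : Measure (E d)) [IsProbabilityMeasure μ] [IsProbabilityMeasure ν],
      μ = ν → tvDist μ ν ≤ δ := by
    rintro μ _ _ _ rfl
    exact ((TVBound.refl μ).mono bot_le).tvDist_le hδ.le
  have hDprob := hprob D
  have hDprob' := hprob D'
  suffices h : ∃ μ' ν' : Measure (E d), ∃ (_ : IsProbabilityMeasure μ')
      (_ : IsProbabilityMeasure ν'), tvDist μ' (outputLaw P g D z) ≤ δ ∧
      tvDist ν' (outputLaw P g D' z) ≤ δ ∧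
      HolderDom q (1500 * α * P.β ^ 2 * (occurrences P z 0 : ℝ) ^ 2) μ' ν' by
    obtain ⟨μ', ν', hμ', hν', h1, h2, h3⟩ := h
    exact ⟨⟨μ', hμ'⟩, ⟨ν', hν'⟩, h1, h2, h3.renyiDiv_le hq⟩
  by_cases heq : outputLaw P g D z = outputLaw P g D' z
  · exact ⟨_, _, hDprob, hDprob', htv0 _ _ rfl, htv0 _ _ rfl, hself _ _ heq⟩
  rcases le_or_gt (1 / 2) δ with hδ2 | hδ2
  · have hmid := isProbabilityMeasure_midpoint (outputLaw P g D z) (outputLaw P g D' z)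
    refine ⟨_, _, hmid, hmid, ?_, ?_, hself _ _ rfl⟩
    · exact ((tvBound_half_midpoint _ _).mono (ENNReal.ofReal_le_ofReal hδ2)).tvDist_le hδ.le
    · rw [add_comm] at hmid ⊢
      exact ((tvBound_half_midpoint _ _).mono (ENNReal.ofReal_le_ofReal hδ2)).tvDist_le hδ.le
  -- In dimension `0` the step size degenerates through the division by `√d`, but the space is a
  -- point and the laws coincide.
  have hd : 0 < d := by
    by_contra hd
    obtain rfl : d = 0 := by omega
    refine heq (Measure.ext fun s _ => ?_)
    rcases s.eq_empty_or_nonempty with rfl | hs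
    · rw [measure_empty, measure_empty]
    · rw [Subsingleton.eq_univ_of_nonempty hs, measure_univ, measure_univ]
  -- For `T = 1` there are no loops, and both outputs are the Dirac mass at the center.
  have hT2 : 2 ≤ P.T := by
    by_contra hT2
    have hT1 : P.T = 1 := by omega
    refine heq ?_
    have hk : P.k = 0 := by rw [Params.k, hT1]; rfl
    rw [outputLaw, outputLaw, hk, outerLaw, outerLaw]
  obtain ⟨m, hm1, hmr, hmδ⟩ := exists_moment_exponent hT2 hδ hδ2 (div_pos hr hρ)
    (by rwa [one_div_div])
  obtain ⟨ν, hν, htv, hdom⟩ := exists_law_near_outputLaw (z := z) hd hr hρ hβ hL hT hg hD hm1 hmr hq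
  exact ⟨_, ν, hDprob, hν, htv0 _ _ rfl,
    (htv.mono (ENNReal.ofReal_le_ofReal hmδ)).tvDist_le hδ.le, hdom⟩

end ReSQue

/-- For `T = 1` the convention `Real.log 0 = 0` turns `hbound` into `0 ≤ ρ / r`, so the condition is
void as intended. Convexity and the Lipschitz bound act only through the oracle: subgradients are
monotone and of norm at most `L`. -/
theorem lemma4p5 {d n : ℕ} [NeZero n] {S : Type*}
    (f : S → ReSQue.E d → ℝ) (g : S → ReSQue.E d → ReSQue.E d) (P : ReSQue.Params d)
    (hr : 0 < P.r) (hρ : 0 < P.ρ) (hβ : 0 < P.β) (hL : 0 < P.L) (hT : 1 ≤ P.T)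
    (hconv : ∀ s, ConvexOn ℝ Set.univ (f s))
    (hlip : ∀ s x y, |f s x - f s y| ≤ P.L * ‖x - y‖)
    (hgm : ∀ s, Measurable (g s))
    (hg : ∀ s x, ReSQue.IsSubgradient (f s) x (g s x))
    (D D' : Fin n → S) (hD : ReSQue.Neighboring D D') (hD0 : D 0 ≠ D' 0)
    (z : ℕ → ℕ → Fin n) (δ : ℝ) (hδ : 0 < δ)
    (hbound : 1728 * Real.log (Real.log P.T / δ) ^ 2 ≤ P.ρ / P.r)
    (α : ℝ) (hα : 1 < α) :
    ReSQue.approxRenyiDiv α δ (ReSQue.outputLaw P g D z) (ReSQue.outputLaw P g D' z) ≤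
        ((1500 * α * P.β ^ 2 * (ReSQue.occurrences P z 0 : ℝ) ^ 2 : ℝ) : EReal) ∧
      ∃ μ' ν' : MeasureTheory.ProbabilityMeasure (ReSQue.E d),
        ReSQue.tvDist (μ' : MeasureTheory.Measure (ReSQue.E d)) (ReSQue.outputLaw P g D z) ≤ δ ∧
        ReSQue.tvDist (ν' : MeasureTheory.Measure (ReSQue.E d)) (ReSQue.outputLaw P g D' z) ≤ δ ∧
        ReSQue.renyiDiv α (μ' : MeasureTheory.Measure (ReSQue.E d))
            (ν' : MeasureTheory.Measure (ReSQue.E d)) ≤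
          ((1500 * α * P.β ^ 2 * (ReSQue.occurrences P z 0 : ℝ) ^ 2 : ℝ) : EReal) := by
  have horacle : ReSQue.IsOracle P.L g :=
    ⟨hgm, fun s x => (hg s x).norm_le hL.le (hlip s), fun s x y => (hg s x).monotone (hg s y)⟩
  have hDeq : ∀ a, a ≠ 0 → D a = D' a := fun a ha => by
    obtain ⟨b, hb⟩ := Set.ncard_eq_one.1 hD
    have h0 : (0 : Fin n) ∈ {i | D i ≠ D' i} := hD0
    by_contra hne
    have h1 : a ∈ {i | D i ≠ D' i} := hne
    rw [hb] at h0 h1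
    exact ha (h1.trans h0.symm)
  have key := ReSQue.exists_renyiDiv_le hr hρ hβ hL hT horacle hDeq z hδ hbound hα
  exact ⟨ReSQue.approxRenyiDiv_le_of_exists key, key⟩
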